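/- **Setting.** Let $n,m,l\ge 0$, $r\ge 1$, $A_i\in\mathbb R^{n\times n}$, $B_i\in\mathbb R^{n\times m}$ ($0\le i\le r-1$), $Q\in\mathbb R^{n\times n}$, $L\in\mathbb R^{n\times m}$, $R\in\mathbb R^{m\times m}$ with $R\succ0$ and $\begin{bmatrix}Q&L\\L^{T}&R\end{bmatrix}\succeq0$. Let $P\in\mathbb R^{m\times m}$ satisfy $P^{T}P=R$ and $C\in\mathbb R^{l\times n}$ satisfy $C^{T}C=Q-LR^{-1}L^{T}$. Let $\Pi$ be the permutation matrix with $\Pi^{T}(X\otimes I_{r-1})\Pi=I_{r-1}\otimes X$ for all $X\in\mathbb R^{n\times n}$, and put $$A=A_0-B_0R^{-1}L^{T},\quad B=B_0P^{-1},\quad \widehat A=\Pi\left(\begin{bmatrix}A_1\\ \vdots\\ A_{r-1}\end{bmatrix}-\begin{bmatrix}B_1\\ \vdots\\ B_{r-1}\end{bmatrix}R^{-1}L^{T}\right),\quad \widehat B=\Pi\begin{bmatrix}B_1\\ \vdots\\ B_{r-1}\end{bmatrix}P^{-1}.$$ For $X\in\mathbb R^{n\times n}$ and $M\in\mathbb R^{p\times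 (r-1)n}$, $N\in\mathbb R^{(r-1)n\times q}$ write $M\ltimes X\ltimes N=M(X\otimes I_{r-1})N$. A stochastic Riccati equation (SCARE) in standard form with coefficients $(H,A,B,\widehat A,\widehat B)$ is $\mathcal C(X)=0$, where $$\mathcal C(X)=H+A^{T}X+XA+\widehat A^{T}\ltimes X\ltimes\widehat A-(XB+\widehat A^{T}\ltimes X\ltimes\widehat B)(I+\widehat B^{T}\ltimes X\ltimes\widehat B)^{-1}(XB+\widehat A^{T}\ltimes X\ltimes\widehat B)^{T}.$$ A solution is a symmetric $X$ for which $I+\widehat B^{T}\ltimes X\ltimes\widehat B$ is invertible and $\mathcal C(X)=0$. A tuple $(M_0,\dots,M_{r-1})$ of $n\times n$ matrices is called stable if $e^{t\mathcal L^*}$, $t\ge0$, is exponentially stable, where $\mathcal L^*(S)=M_0^{T}S+SM_0+\sum_{i=1}^{r-1}M_i^{T}SM_i$ acts on symmetric matrices. A solution $X$ is stabilizing if $(M_0,\dots,M_{r-1})$ is stable, where $M_0=A+B\widehat F_X$, the matrices $M_1,\dots,M_{r-1}$ are the $n\times n$ blocks of $\Pi^{T}\widehat A+\Pi^{T}\widehat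 B\widehat F_X$, and $\widehat F_X=-(I+\widehat B^{T}\ltimes X\ltimes\widehat B)^{-1}(XB+\widehat A^{T}\ltimes X\ltimes\widehat B)^{T}$. The pair $(\{A_i\},\{B_i\})$ is stabilizable if $(A_i+B_iF)_{i=0}^{r-1}$ is stable for some $F\in\mathbb R^{m\times n}$. The pair $(\{M_i\},C)$ is detectable if $(\{M_i^{T}\},\{C_i^{T}\})$ is stabilizable, where $C_0=C$ and $C_i=0$ for $i\ge1$. **Theorem 2.1.** Let $\mathcal C$ be the operator above with $H=C^{T}C$. Let $X\succeq0$ with $\mathcal C(X)\succeq0$, let $P_X\in\mathbb R^{m\times m}$ satisfy $P_X^{T}P_X=R_X:=I+\widehat B^{T}\ltimes X\ltimes\widehat B$, and put $$B_X=BP_X^{-1},\quad \widehat B_X=\widehat BP_X^{-1},\quad L_X^{T}=B_X^{T}X+\widehat B_X^{T}\ltimes X\ltimes\widehat A,\quad A_X=A-B_XL_X^{T},\quad \widehat A_X=\widehat A-\widehat B_XL_X^{T}.$$ Let $\mathcal C_X$ be the standard-form operator with coefficients $(\mathcal C(X),A_X,B_X,\widehat A_X,\widehat B_X)$; thus $\mathcal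 C_X(0)=\mathcal C(X)$. 1. For every symmetric $\Delta$, the matrix $I+\widehat B_X^{T}\ltimes\Delta\ltimes\widehat B_X$ is invertible if and only if $I+\widehat B^{T}\ltimes(X+\Delta)\ltimes\widehat B$ is, and in that case $\mathcal C_X(\Delta)=\mathcal C(X+\Delta)$. Moreover, $X_\star-X$ is a solution of $\mathcal C_X(\Delta)=0$ if and only if $X_\star$ is a solution of $\mathcal C(X)=0$. 2. $X_\star-X$ is a stabilizing solution of $\mathcal C_X(\Delta)=0$ if and only if $X_\star$ is a stabilizing solution of $\mathcal C(X)=0$. 3. Suppose that $(\{A_i\}_{i=0}^{r-1},\{B_i\}_{i=0}^{r-1})$ is stabilizable and $(\{A_i-B_iR^{-1}L^{T}\}_{i=0}^{r-1},C)$ is detectable. Then $\mathcal C_X(\Delta)=0$ has exactly one stabilizing solution $\Delta_\star$, and $\Delta_\star\succeq0$. -/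

import Mathlib

open scoped Matrix Kronecker

/-- The left semi-tensor product `M ⋉ X = M (X ⊗ I)` in the case used here: the number of columns
of `M` (indexed by `p × κ`) is a multiple of the number of rows of `X` (indexed by `p`). The pair
index of `p × κ` is the usual one of a Kronecker product. If the factor on the right of `M ⋉ X`
has a matching number of rows, `⋉` is the ordinary product, which is written `*`. -/
def semiTensor {ι p q κ : Type*} [Fintype p] [Fintype κ] [DecidableEq κ]
    (M : Matrix ι (p × κ) ℝ) (X : Matrix p q ℝ) : Matrix ι (q × κ) ℝ :=
  M * (X ⊗ₖ (1 : Matrix κ κ ℝ))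

infixl:70 " ⋉ " => semiTensor

/-- The permutation matrix `Π` with `Πᵀ (X ⊗ I) Π = I ⊗ X`. -/
def shuffle (n k : ℕ) : Matrix (Fin n × Fin k) (Fin k × Fin n) ℝ :=
  (1 : Matrix (Fin n × Fin k) (Fin n × Fin k) ℝ).submatrix id Prod.swap

theorem shuffle_transpose_mul_mul (n k : ℕ) (X : Matrix (Fin n) (Fin n) ℝ) :
    (shuffle n k)ᵀ * (X ⊗ₖ (1 : Matrix (Fin k) (Fin k) ℝ)) * shuffle n k
      = (1 : Matrix (Fin k) (Fin k) ℝ) ⊗ₖ X := by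
  ext ⟨a, i⟩ ⟨b, j⟩
  simp [shuffle, Matrix.mul_apply, Matrix.one_apply, Matrix.kroneckerMap_apply, mul_comm]

/-- The blocks `M₁, …, M_k` stacked on top of each other. -/
def stackBlocks {n k q : ℕ} (M : Fin k → Matrix (Fin n) (Fin q) ℝ) :
    Matrix (Fin k × Fin n) (Fin q) ℝ :=
  Matrix.of fun p j => M p.1 p.2 j

/-- The `i`-th block of a stacked matrix. -/
def blockOf {n k q : ℕ} (M : Matrix (Fin k × Fin n) (Fin q) ℝ) (i : Fin k) :
    Matrix (Fin n) (Fin q) ℝ :=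
  Matrix.of fun a j => M (i, a) j

/-- The (adjoint) Lyapunov operator `S ↦ A₀ᵀ S + S A₀ + ∑ i, Aᵢᵀ S Aᵢ` of the linear stochastic
system `dx = A₀ x dt + ∑ i, Aᵢ x dwᵢ`. -/
def lyapunovOp {n k : ℕ} (A₀ : Matrix (Fin n) (Fin n) ℝ) (A : Fin k → Matrix (Fin n) (Fin n) ℝ) :
    Matrix (Fin n) (Fin n) ℝ →ₗ[ℝ] Matrix (Fin n) (Fin n) ℝ where
  toFun S := A₀ᵀ * S + S * A₀ + ∑ i, (A i)ᵀ * S * A i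
  map_add' S T := by
    simp only [Matrix.mul_add, Matrix.add_mul, Finset.sum_add_distrib]
    abel
  map_smul' c S := by
    simp only [Matrix.mul_smul, Matrix.smul_mul, ← Finset.smul_sum, ← smul_add, RingHom.id_apply]

/-- The Lyapunov operator as a continuous linear map on `ℝ^{n × n}`, here the normed space
`Fin n → Fin n → ℝ` (largest absolute value of an entry; all norms are equivalent). -/
noncomputable def lyapunovCLM {n k : ℕ} (A₀ : Matrix (Fin n) (Fin n) ℝ)
    (A : Fin k → Matrix (Fin n) (Fin n) ℝ) : (Fin n → Fin n → ℝ) →L[ℝ] (Fin n → Fin n → ℝ) :=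
  LinearMap.toContinuousLinearMap
    ((Matrix.ofLinearEquiv ℝ).symm.toLinearMap ∘ₗ lyapunovOp A₀ A ∘ₗ
      (Matrix.ofLinearEquiv ℝ).toLinearMap)

/-- The system `(A₀, A₁, …, A_k)` is stable: with `𝓛` its Lyapunov operator, the semigroup
`exp (t 𝓛)` decays exponentially on the space of symmetric matrices. -/
def SystemStable {n k : ℕ} (A₀ : Matrix (Fin n) (Fin n) ℝ)
    (A : Fin k → Matrix (Fin n) (Fin n) ℝ) : Prop :=
  ∃ β α : ℝ, 0 < α ∧ ∀ t : ℝ, 0 ≤ t → ∀ S : Fin n → Fin n → ℝ, (Matrix.of S).IsSymm →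
    ‖NormedSpace.exp (t • lyapunovCLM A₀ A) S‖ ≤ β * Real.exp (-α * t) * ‖S‖

/-- The pair `({Aᵢ}, {Bᵢ})`, `i = 0, …, k`, is stabilizable. -/
def Stabilizable {n m k : ℕ} (A₀ : Matrix (Fin n) (Fin n) ℝ)
    (A : Fin k → Matrix (Fin n) (Fin n) ℝ) (B₀ : Matrix (Fin n) (Fin m) ℝ)
    (B : Fin k → Matrix (Fin n) (Fin m) ℝ) : Prop :=
  ∃ F : Matrix (Fin m) (Fin n) ℝ, SystemStable (A₀ + B₀ * F) (fun i => A i + B i * F)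

/-- The pair `({Aᵢ}, C)`, `i = 0, …, k`, is detectable: `({Aᵢᵀ}, {Cᵢᵀ})` is stabilizable, with
`C₀ = C` and `Cᵢ = 0` for `i ≥ 1`. -/
def Detectable {n l k : ℕ} (A₀ : Matrix (Fin n) (Fin n) ℝ)
    (A : Fin k → Matrix (Fin n) (Fin n) ℝ) (C : Matrix (Fin l) (Fin n) ℝ) : Prop :=
  Stabilizable A₀ᵀ (fun i => (A i)ᵀ) Cᵀ (fun _ => 0)

/-- Coefficients of a stochastic Riccati equation in standard form, with state dimension `n`,
control dimension `m`, and `k` noise processes. `H` is the constant term. -/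
structure StdSCARE (n m k : ℕ) where
  H : Matrix (Fin n) (Fin n) ℝ
  A : Matrix (Fin n) (Fin n) ℝ
  B : Matrix (Fin n) (Fin m) ℝ
  Ahat : Matrix (Fin n × Fin k) (Fin n) ℝ
  Bhat : Matrix (Fin n × Fin k) (Fin m) ℝ

namespace StdSCARE

variable {n m k : ℕ} (E : StdSCARE n m k)

/-- `R_X = I + B̂ᵀ ⋉ X ⋉ B̂`. -/
def weight (X : Matrix (Fin n) (Fin n) ℝ) : Matrix (Fin m) (Fin m) ℝ :=
  1 + E.Bhatᵀ ⋉ X * E.Bhat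

/-- `X B + Âᵀ ⋉ X ⋉ B̂`. -/
def cross (X : Matrix (Fin n) (Fin n) ℝ) : Matrix (Fin n) (Fin m) ℝ :=
  X * E.B + E.Ahatᵀ ⋉ X * E.Bhat

/-- The residual operator. Its inverse is meaningful only where `E.weight X` is invertible. -/
noncomputable def residual (X : Matrix (Fin n) (Fin n) ℝ) : Matrix (Fin n) (Fin n) ℝ :=
  E.H + E.Aᵀ * X + X * E.A + E.Ahatᵀ ⋉ X * E.Ahat
    - E.cross X * (E.weight X)⁻¹ * (E.cross X)ᵀ

/-- The feedback `F̂_X = -(I + B̂ᵀ ⋉ X ⋉ B̂)⁻¹ (X B + Âᵀ ⋉ X ⋉ B̂)ᵀ`. -/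
noncomputable def feedback (X : Matrix (Fin n) (Fin n) ℝ) : Matrix (Fin m) (Fin n) ℝ :=
  -((E.weight X)⁻¹ * (E.cross X)ᵀ)

/-- `X` is a (symmetric) solution; the inverse in the equation has to exist. -/
def IsSolution (X : Matrix (Fin n) (Fin n) ℝ) : Prop :=
  X.IsSymm ∧ IsUnit (E.weight X) ∧ E.residual X = 0

/-- `X` is a stabilizing solution: the closed-loop system with coefficients `A + B F̂_X` and the
blocks of `Πᵀ Â + Πᵀ B̂ F̂_X` is stable. -/
def IsStabilizingSolution (X : Matrix (Fin n) (Fin n) ℝ) : Prop :=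
  E.IsSolution X ∧
    SystemStable (E.A + E.B * E.feedback X)
      (blockOf ((shuffle n k)ᵀ * E.Ahat + (shuffle n k)ᵀ * E.Bhat * E.feedback X))

/-- `L_Xᵀ = B_Xᵀ X + B̂_Xᵀ ⋉ X ⋉ Â`, with `B_X = B P_X⁻¹` and `B̂_X = B̂ P_X⁻¹`. -/
noncomputable def crossT (X : Matrix (Fin n) (Fin n) ℝ) (PX : Matrix (Fin m) (Fin m) ℝ) :
    Matrix (Fin m) (Fin n) ℝ :=
  (E.B * PX⁻¹)ᵀ * X + (E.Bhat * PX⁻¹)ᵀ ⋉ X * E.Ahat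

/-- The transformed equation: coefficients `A_X = A - B_X L_Xᵀ`, `B_X`, `Â_X = Â - B̂_X L_Xᵀ`,
`B̂_X`, and constant term the residual of `E` at `X`. -/
noncomputable def incorporate (X : Matrix (Fin n) (Fin n) ℝ) (PX : Matrix (Fin m) (Fin m) ℝ) :
    StdSCARE n m k where
  H := E.residual X
  A := E.A - E.B * PX⁻¹ * E.crossT X PX
  B := E.B * PX⁻¹
  Ahat := E.Ahat - E.Bhat * PX⁻¹ * E.crossT X PX
  Bhat := E.Bhat * PX⁻¹

end StdSCARE

/-- Data `Aᵢ, Bᵢ` (`i = 0, …, k`), `Q`, `L`, `R` of a stochastic linear-quadratic problem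
with `k` noise processes. -/
structure SCAREData (n m k : ℕ) where
  A₀ : Matrix (Fin n) (Fin n) ℝ
  A : Fin k → Matrix (Fin n) (Fin n) ℝ
  B₀ : Matrix (Fin n) (Fin m) ℝ
  B : Fin k → Matrix (Fin n) (Fin m) ℝ
  Q : Matrix (Fin n) (Fin n) ℝ
  L : Matrix (Fin n) (Fin m) ℝ
  R : Matrix (Fin m) (Fin m) ℝ

/-- The standard form, for `Pᵀ P = R` and `Cᵀ C = Q - L R⁻¹ Lᵀ`. -/
noncomputable def SCAREData.toStd {n m k l : ℕ} (D : SCAREData n m k)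
    (P : Matrix (Fin m) (Fin m) ℝ) (C : Matrix (Fin l) (Fin n) ℝ) : StdSCARE n m k where
  H := Cᵀ * C
  A := D.A₀ - D.B₀ * D.R⁻¹ * D.Lᵀ
  B := D.B₀ * P⁻¹
  Ahat := shuffle n k * (stackBlocks D.A - stackBlocks D.B * D.R⁻¹ * D.Lᵀ)
  Bhat := shuffle n k * stackBlocks D.B * P⁻¹

/-!
Throughout, a feedback `F` is tied to `X` by the identity (completion of squares)
`H + Fᵀ F + 𝓛_F X = 𝒞(X) + (F - F_X)ᵀ R_X (F - F_X)`, where `𝓛_F` is the Lyapunov operator of the closed loop under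
`u = F x` (`StdSCARE.mixedResidual_self_eq`). Polarized in `F`, it says that the mixed expression
`H + Fᵀ G + (A + B F)ᵀ X + X (A + B G) + ∑ (Aᵢ + Bᵢ F)ᵀ X (Aᵢ + Bᵢ G)` equals `𝒞(X)` as soon as one
of `F`, `G` is `F_X`.

*Shifted equation.* Passing to `𝒞_X` is the change of control `u = F_X x + P_X⁻¹ v`. The feedback
of `𝒞_X` at `Δ` is `P_X (F_{X+Δ} - F_X)` (`StdSCARE.incorporate_feedback`), so the closed loops of
`𝒞_X` at `Δ` and of `𝒞` at `X + Δ` are the same. Equality of the residuals follows from the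
identity above, and stabilizing solutions correspond.

*Stability.* Exponential stability is equivalent to Lyapunov's criterion: `𝓛 Z < 0` for some
`Z ≥ 0` (`systemStable_iff_lyapStable`). This rests on positivity of the Lyapunov semigroup
(`exp_lyapunov_posSemidef`). From the criterion one gets by linear algebra the comparison principle
`𝓛 S ≤ 0 → 0 ≤ S` (`LyapStable.posSemidef_of_lyapOp`), injectivity of the mixed operator of two
stable systems (`LyapStable.eq_zero_of_mixed`), stability of the transposed system, and the
consequence of detectability that `X ≥ 0` with `H + Fᵀ F + 𝓛_F X ≤ 0` forces `F` to be stabilizing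
(`StdSCARE.closedStable_of_mixedResidual`).

*Stabilizing solution.* The difference of two stabilizing solutions is in the kernel of a mixed
operator, so it vanishes. For existence, the set of `X ≥ 0` with `𝒞(X) ≤ 0` is closed and, by
stabilizability, nonempty; an element of smallest trace is fixed by a Newton step and hence is a
stabilizing solution `Y` of `𝒞(X) = 0`. Finally `𝓛_{F_Y} (Y - X) ≤ 0` by completion of squares, so
the comparison principle gives `0 ≤ Y - X`.
-/

open Matrix Finset

/-! ### Positive semidefinite real matrices -/

theorem Matrix.posSemidef_real_iff {ι : Type*} [Fintype ι] {S : Matrix ι ι ℝ} :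
    S.PosSemidef ↔ S.IsSymm ∧ ∀ x : ι → ℝ, 0 ≤ x ⬝ᵥ S *ᵥ x := by
  rw [posSemidef_iff_dotProduct_mulVec]
  simp [IsHermitian, IsSymm, conjTranspose_eq_transpose_of_trivial]

theorem Matrix.posDef_real_iff {ι : Type*} [Fintype ι] {S : Matrix ι ι ℝ} :
    S.PosDef ↔ S.IsSymm ∧ ∀ x : ι → ℝ, x ≠ 0 → 0 < x ⬝ᵥ S *ᵥ x := by
  rw [posDef_iff_dotProduct_mulVec]
  simp [IsHermitian, IsSymm, conjTranspose_eq_transpose_of_trivial]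

section Order

variable {ι : Type*} [Fintype ι]

theorem Matrix.PosSemidef.isSymm {S : Matrix ι ι ℝ} (h : S.PosSemidef) : S.IsSymm :=
  (posSemidef_real_iff.1 h).1

theorem Matrix.PosSemidef.quad_nonneg {S : Matrix ι ι ℝ} (h : S.PosSemidef) (x : ι → ℝ) :
    0 ≤ x ⬝ᵥ S *ᵥ x :=
  (posSemidef_real_iff.1 h).2 x

theorem Matrix.PosDef.quad_pos {S : Matrix ι ι ℝ} (h : S.PosDef) {x : ι → ℝ} (hx : x ≠ 0) :
    0 < x ⬝ᵥ S *ᵥ x :=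
  (posDef_real_iff.1 h).2 x hx

theorem Matrix.PosSemidef.mulVec_eq_zero {S : Matrix ι ι ℝ} (h : S.PosSemidef) {x : ι → ℝ}
    (hx : x ⬝ᵥ S *ᵥ x = 0) : S *ᵥ x = 0 :=
  (h.dotProduct_mulVec_zero_iff x).1 (by simpa using hx)

theorem Matrix.PosSemidef.congr {p : Type*} [Fintype p] {S : Matrix ι ι ℝ} (h : S.PosSemidef)
    (B : Matrix ι p ℝ) : (Bᵀ * S * B).PosSemidef := by
  simpa [conjTranspose_eq_transpose_of_trivial] using h.conjTranspose_mul_mul_same B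

theorem Matrix.posSemidef_transpose_mul_self {p : Type*} [Fintype p] (B : Matrix ι p ℝ) :
    (Bᵀ * B).PosSemidef := by
  simpa [conjTranspose_eq_transpose_of_trivial] using posSemidef_conjTranspose_mul_self B

theorem Matrix.PosSemidef.eq_zero_of_neg {S : Matrix ι ι ℝ} (h : S.PosSemidef)
    (h' : (-S).PosSemidef) : S = 0 := by
  rw [← h.trace_eq_zero_iff]
  have h1 := h.trace_nonneg
  have h2 := h'.trace_nonneg
  rw [trace_neg] at h2
  linarith

theorem Matrix.quad_transpose (S : Matrix ι ι ℝ) (x : ι → ℝ) :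
    x ⬝ᵥ Sᵀ *ᵥ x = x ⬝ᵥ S *ᵥ x := by
  rw [mulVec_transpose, dotProduct_comm, dotProduct_mulVec]

theorem Matrix.quad_le_sum_abs (S : Matrix ι ι ℝ) (x : ι → ℝ) :
    x ⬝ᵥ S *ᵥ x ≤ (∑ i, ∑ j, |S i j|) * (x ⬝ᵥ x) := by
  have hx : ∀ i, x i ^ 2 ≤ x ⬝ᵥ x := fun i => by
    rw [sq]
    exact Finset.single_le_sum (f := fun j => x j * x j) (fun j _ => mul_self_nonneg _)
      (mem_univ i)
  simp only [sum_mul]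
  rw [dotProduct]
  refine sum_le_sum fun i _ => ?_
  rw [mulVec, dotProduct, mul_sum]
  refine sum_le_sum fun j _ => ?_
  have h1 : |x i * x j| ≤ x ⬝ᵥ x := by
    rw [abs_le]
    constructor <;> nlinarith [hx i, hx j, sq_nonneg (x i - x j), sq_nonneg (x i + x j)]
  calc x i * (S i j * x j) = S i j * (x i * x j) := by ring
    _ ≤ |S i j * (x i * x j)| := le_abs_self _
    _ = |S i j| * |x i * x j| := abs_mul _ _
    _ ≤ |S i j| * (x ⬝ᵥ x) := by gcongr

theorem Matrix.PosSemidef.abs_apply_le_trace [DecidableEq ι] {S : Matrix ι ι ℝ}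
    (h : S.PosSemidef) (i j : ι) : |S i j| ≤ S.trace := by
  have hd : ∀ i, 0 ≤ S i i := fun i => h.diag_nonneg
  have ht : ∀ i, S i i ≤ S.trace := fun i =>
    Finset.single_le_sum (f := fun i => S i i) (fun i _ => hd i) (mem_univ i)
  have hs : S j i = S i j := h.isSymm.apply i j
  have h1 := h.quad_nonneg (Pi.single i 1 + Pi.single j 1)
  have h2 := h.quad_nonneg (Pi.single i 1 - Pi.single j 1)
  simp only [mulVec_add, mulVec_sub, add_dotProduct, sub_dotProduct, dotProduct_add,
    dotProduct_sub, single_one_dotProduct, mulVec_single_one, col_apply] at h1 h2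
  rw [abs_le]
  constructor <;> linarith [ht i, ht j]

/-- The smallest eigenvalue `c` of the symmetric pencil `S - c Z` with `Z` positive definite: it
is the minimum of the Rayleigh quotient, and the shifted matrix is positive semidefinite with a
nontrivial kernel. -/
theorem Matrix.PosDef.exists_min_pencil_eigenvalue [Nonempty ι] {Z S : Matrix ι ι ℝ}
    (hZ : Z.PosDef) (hS : S.IsSymm) :
    ∃ (c : ℝ) (x : ι → ℝ), x ≠ 0 ∧ (S - c • Z).PosSemidef ∧ (S - c • Z) *ᵥ x = 0 := by
  have hcont : ∀ T : Matrix ι ι ℝ, Continuous fun x : ι → ℝ => x ⬝ᵥ T *ᵥ x := fun T => by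
    fun_prop
  have hne : ∀ x ∈ Metric.sphere (0 : ι → ℝ) 1, x ≠ 0 := fun x hx h0 => by simp [h0] at hx
  obtain ⟨x₀, hx₀, hmin⟩ := (isCompact_sphere (0 : ι → ℝ) 1).exists_isMinOn
    (NormedSpace.sphere_nonempty.2 zero_le_one)
    (f := fun x => (x ⬝ᵥ S *ᵥ x) / (x ⬝ᵥ Z *ᵥ x))
    ((hcont S).continuousOn.div (hcont Z).continuousOn
      fun x hx => (hZ.quad_pos (hne x hx)).ne')
  set c := (x₀ ⬝ᵥ S *ᵥ x₀) / (x₀ ⬝ᵥ Z *ᵥ x₀) with hc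
  have hquad : ∀ x, x ⬝ᵥ (S - c • Z) *ᵥ x = x ⬝ᵥ S *ᵥ x - c * (x ⬝ᵥ Z *ᵥ x) := fun x => by
    simp [sub_mulVec, smul_mulVec, dotProduct_sub, dotProduct_smul]
  have hpsd : (S - c • Z).PosSemidef := by
    refine posSemidef_real_iff.2 ⟨hS.sub (hZ.posSemidef.isSymm.smul c), fun x => ?_⟩
    rcases eq_or_ne x 0 with rfl | hx
    · simp
    have hn : ‖x‖ ≠ 0 := norm_ne_zero_iff.2 hx
    have hy : ‖x‖⁻¹ • x ∈ Metric.sphere (0 : ι → ℝ) 1 := by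
      simp [norm_smul, inv_mul_cancel₀ hn]
    have h1 : c ≤ _ := hmin hy
    have h2 : ∀ T : Matrix ι ι ℝ, (‖x‖⁻¹ • x) ⬝ᵥ T *ᵥ (‖x‖⁻¹ • x)
        = ‖x‖⁻¹ * ‖x‖⁻¹ * (x ⬝ᵥ T *ᵥ x) := fun T => by
      simp only [mulVec_smul, smul_dotProduct, dotProduct_smul, smul_eq_mul]; ring
    simp only [h2] at h1
    rw [mul_div_mul_left _ _ (by positivity), le_div_iff₀ (hZ.quad_pos hx)] at h1
    rw [hquad]
    linarith
  refine ⟨c, x₀, hne _ hx₀, hpsd, hpsd.mulVec_eq_zero ?_⟩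
  rw [hquad, hc, div_mul_cancel₀ _ (hZ.quad_pos (hne _ hx₀)).ne', sub_self]

/-- A positive definite matrix dominates a positive multiple of any other one. -/
theorem Matrix.PosDef.exists_pos_smul_le {Z S : Matrix ι ι ℝ} (hZ : Z.PosDef) (hS : S.PosDef) :
    ∃ c : ℝ, 0 < c ∧ (S - c • Z).PosSemidef := by
  cases isEmpty_or_nonempty ι
  · refine ⟨1, one_pos, ?_⟩
    rw [Subsingleton.elim (S - (1 : ℝ) • Z) 0]
    exact PosSemidef.zero
  obtain ⟨c, x, hx, h, h0⟩ := hZ.exists_min_pencil_eigenvalue hS.posSemidef.isSymm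
  refine ⟨c, ?_, h⟩
  have h1 : x ⬝ᵥ (S - c • Z) *ᵥ x = 0 := by rw [h0, dotProduct_zero]
  simp only [sub_mulVec, smul_mulVec, dotProduct_sub, dotProduct_smul, smul_eq_mul] at h1
  have h2 := hS.quad_pos hx
  have h3 := hZ.quad_pos hx
  by_contra! hc
  nlinarith

end Order

/-! ### Lyapunov's criterion, comparison principle and perturbations -/

section Lyapunov

variable {ι κ : Type*} [Fintype ι] [Fintype κ]

/-- The Lyapunov operator `S ↦ M₀ᵀ S + S M₀ + ∑ i, Mᵢᵀ S Mᵢ` for arbitrary finite index types, as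
needed for block systems. -/
def lyapOp (M₀ : Matrix ι ι ℝ) (M : κ → Matrix ι ι ℝ) : Matrix ι ι ℝ →ₗ[ℝ] Matrix ι ι ℝ where
  toFun S := M₀ᵀ * S + S * M₀ + ∑ i, (M i)ᵀ * S * M i
  map_add' S T := by
    simp only [Matrix.mul_add, Matrix.add_mul, Finset.sum_add_distrib]
    abel
  map_smul' c S := by
    simp only [Matrix.mul_smul, Matrix.smul_mul, ← Finset.smul_sum, ← smul_add, RingHom.id_apply]

/-- Lyapunov's criterion for stability: `𝓛 Z < 0` has a positive semidefinite solution `Z`. -/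
def LyapStable (M₀ : Matrix ι ι ℝ) (M : κ → Matrix ι ι ℝ) : Prop :=
  ∃ Z : Matrix ι ι ℝ, Z.PosSemidef ∧ (-lyapOp M₀ M Z).PosDef

variable {M₀ : Matrix ι ι ℝ} {M : κ → Matrix ι ι ℝ}

theorem lyapOp_apply (S : Matrix ι ι ℝ) :
    lyapOp M₀ M S = M₀ᵀ * S + S * M₀ + ∑ i, (M i)ᵀ * S * M i := rfl

theorem lyapOp_transpose (S : Matrix ι ι ℝ) : lyapOp M₀ M Sᵀ = (lyapOp M₀ M S)ᵀ := by
  simp only [lyapOp_apply, transpose_add, transpose_sum, transpose_mul, transpose_transpose,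
    Matrix.mul_assoc]
  abel

theorem Matrix.IsSymm.lyapOp {S : Matrix ι ι ℝ} (hS : S.IsSymm) : (lyapOp M₀ M S).IsSymm := by
  rw [IsSymm, ← lyapOp_transpose, hS.eq]

/-- `𝓛 S` is nonnegative on the kernel of a positive semidefinite `S`, since the terms with `M₀`
vanish there. -/
theorem Matrix.PosSemidef.lyapOp_quad_nonneg {S : Matrix ι ι ℝ} (hS : S.PosSemidef) {x : ι → ℝ}
    (hx : S *ᵥ x = 0) : 0 ≤ x ⬝ᵥ lyapOp M₀ M S *ᵥ x := by
  have h1 : x ⬝ᵥ (M₀ᵀ * S) *ᵥ x = 0 := by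
    rw [← mulVec_mulVec, hx, mulVec_zero, dotProduct_zero]
  have h2 : x ⬝ᵥ (S * M₀) *ᵥ x = 0 := by
    rw [← quad_transpose, transpose_mul, hS.isSymm.eq, h1]
  rw [lyapOp_apply, add_mulVec, add_mulVec, dotProduct_add, dotProduct_add, h1, h2, zero_add,
    zero_add]
  exact (posSemidef_sum _ fun i _ => hS.congr (M i)).quad_nonneg x

theorem Matrix.PosSemidef.posDef_of_lyapOp {Z : Matrix ι ι ℝ} (hZ : Z.PosSemidef)
    (h : (-lyapOp M₀ M Z).PosDef) : Z.PosDef := by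
  refine posDef_real_iff.2 ⟨hZ.isSymm, fun x hx => (hZ.quad_nonneg x).lt_of_ne' fun h0 => ?_⟩
  have h1 := hZ.lyapOp_quad_nonneg (M₀ := M₀) (M := M) (hZ.mulVec_eq_zero h0)
  have h2 := h.quad_pos hx
  rw [neg_mulVec, dotProduct_neg] at h2
  linarith

/-- The comparison principle. Let `c` be the smallest eigenvalue of the pencil of `S` and a Lyapunov
matrix `Z`, and let `x` be in the kernel of `S - c Z ≥ 0`. If `c < 0`, then `xᵀ 𝓛(S - c Z) x` is
both nonnegative and negative; so `S ≥ c Z ≥ 0`. -/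
theorem LyapStable.posSemidef_of_lyapOp (h : LyapStable M₀ M) {S : Matrix ι ι ℝ} (hS : S.IsSymm)
    (hLS : (-lyapOp M₀ M S).PosSemidef) : S.PosSemidef := by
  obtain ⟨Z, hZ, hLZ⟩ := h
  have hZ' := hZ.posDef_of_lyapOp hLZ
  cases isEmpty_or_nonempty ι
  · rw [Subsingleton.elim S 0]
    exact PosSemidef.zero
  obtain ⟨c, x, hx, hT, hTx⟩ := hZ'.exists_min_pencil_eigenvalue hS
  have hc : 0 ≤ c := by
    by_contra! hc
    have h1 := hT.lyapOp_quad_nonneg (M₀ := M₀) (M := M) hTx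
    have h2 := hLS.quad_nonneg x
    have h3 := hLZ.quad_pos hx
    simp only [map_sub, map_smul, sub_mulVec, smul_mulVec, neg_mulVec, dotProduct_sub,
      dotProduct_smul, dotProduct_neg, smul_eq_mul] at h1 h2 h3
    nlinarith
  have h := hT.add (hZ.smul hc)
  rwa [sub_add_cancel] at h

theorem LyapStable.eq_zero_of_isSymm (h : LyapStable M₀ M) {S : Matrix ι ι ℝ} (hS : S.IsSymm)
    (hLS : lyapOp M₀ M S = 0) : S = 0 := by
  have h1 := h.posSemidef_of_lyapOp hS (by rw [hLS, neg_zero]; exact PosSemidef.zero)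
  have h2 := h.posSemidef_of_lyapOp hS.neg
    (by rw [map_neg, hLS, neg_zero, neg_zero]; exact PosSemidef.zero)
  exact h1.eq_zero_of_neg h2

theorem Matrix.PosDef.fromBlocks_diagonal {ι' : Type*} [Fintype ι'] {S : Matrix ι ι ℝ}
    {T : Matrix ι' ι' ℝ} (hS : S.PosDef) (hT : T.PosDef) : (fromBlocks S 0 0 T).PosDef := by
  refine posDef_real_iff.2 ⟨?_, fun x hx => ?_⟩
  · rw [IsSymm, fromBlocks_transpose, hS.posSemidef.isSymm.eq, hT.posSemidef.isSymm.eq]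
    simp
  obtain ⟨y, z, rfl⟩ : ∃ y z, x = Sum.elim y z := ⟨_, _, (Sum.elim_comp_inl_inr x).symm⟩
  have key : Sum.elim y z ⬝ᵥ fromBlocks S 0 0 T *ᵥ Sum.elim y z
      = y ⬝ᵥ S *ᵥ y + z ⬝ᵥ T *ᵥ z := by
    simp [fromBlocks_mulVec, Function.comp_def, dotProduct]
  rw [key]
  by_cases hy : y = 0
  · have hz : z ≠ 0 := by
      rintro rfl
      exact hx (by rw [hy]; ext (i | i) <;> rfl)
    exact add_pos_of_nonneg_of_pos (hS.posSemidef.quad_nonneg y) (hT.quad_pos hz)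
  · exact add_pos_of_pos_of_nonneg (hS.quad_pos hy) (hT.posSemidef.quad_nonneg z)

/-- The Lyapunov operator of a block diagonal system acts blockwise; the off-diagonal block is the
mixed operator, which is therefore injective if both systems are stable. -/
theorem LyapStable.eq_zero_of_mixed {ι' : Type*} [Fintype ι']
    {N₀ : Matrix ι' ι' ℝ} {N : κ → Matrix ι' ι' ℝ}
    (hM : LyapStable M₀ M) (hN : LyapStable N₀ N) {D : Matrix ι ι' ℝ}
    (hD : M₀ᵀ * D + D * N₀ + ∑ i, (M i)ᵀ * D * N i = 0) : D = 0 := by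
  have hop : ∀ S₁₁ S₁₂ S₂₁ S₂₂, lyapOp (fromBlocks M₀ 0 0 N₀) (fun i => fromBlocks (M i) 0 0 (N i))
      (fromBlocks S₁₁ S₁₂ S₂₁ S₂₂) = fromBlocks (lyapOp M₀ M S₁₁)
        (M₀ᵀ * S₁₂ + S₁₂ * N₀ + ∑ i, (M i)ᵀ * S₁₂ * N i)
        (N₀ᵀ * S₂₁ + S₂₁ * M₀ + ∑ i, (N i)ᵀ * S₂₁ * M i) (lyapOp N₀ N S₂₂) := by
    intro S₁₁ S₁₂ S₂₁ S₂₂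
    have hsum : ∀ (a : κ → Matrix ι ι ℝ) (b : κ → Matrix ι ι' ℝ) (c : κ → Matrix ι' ι ℝ)
        (d : κ → Matrix ι' ι' ℝ), ∑ i, fromBlocks (a i) (b i) (c i) (d i)
          = fromBlocks (∑ i, a i) (∑ i, b i) (∑ i, c i) (∑ i, d i) := by
      intro a b c d
      ext (i | i) (j | j) <;> simp [Matrix.sum_apply]
    simp [lyapOp_apply, fromBlocks_transpose, fromBlocks_multiply, fromBlocks_add, hsum]
  have hst : LyapStable (fromBlocks M₀ 0 0 N₀) (fun i => fromBlocks (M i) 0 0 (N i)) := by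
    obtain ⟨Y, hY, hLY⟩ := hM
    obtain ⟨Z, hZ, hLZ⟩ := hN
    refine ⟨fromBlocks Y 0 0 Z,
      ((hY.posDef_of_lyapOp hLY).fromBlocks_diagonal (hZ.posDef_of_lyapOp hLZ)).posSemidef, ?_⟩
    rw [hop, fromBlocks_neg]
    simpa using hLY.fromBlocks_diagonal hLZ
  have h0 : fromBlocks 0 D Dᵀ 0 = 0 := by
    refine hst.eq_zero_of_isSymm (by simp [IsSymm, fromBlocks_transpose]) ?_
    have hD' := congrArg transpose hD
    simp only [transpose_add, transpose_sum, transpose_mul, transpose_transpose, transpose_zero,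
      ← Matrix.mul_assoc] at hD'
    rw [add_comm (Dᵀ * M₀)] at hD'
    rw [hop, hD, hD', map_zero, map_zero, fromBlocks_zero]
  rw [← fromBlocks_zero, fromBlocks_inj] at h0
  exact h0.2.1

theorem LyapStable.lyapOp_injective (h : LyapStable M₀ M) :
    Function.Injective (lyapOp M₀ M) := by
  rw [← LinearMap.ker_eq_bot, LinearMap.ker_eq_bot']
  exact fun D hD => h.eq_zero_of_mixed h hD

theorem LyapStable.exists_lyapOp_eq (h : LyapStable M₀ M) {W : Matrix ι ι ℝ} (hW : W.IsSymm) :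
    ∃ Y : Matrix ι ι ℝ, Y.IsSymm ∧ lyapOp M₀ M Y = W := by
  obtain ⟨Y, hY⟩ := LinearMap.injective_iff_surjective.1 h.lyapOp_injective W
  refine ⟨Y, h.lyapOp_injective ?_, hY⟩
  rw [lyapOp_transpose, hY, hW.eq]

theorem LyapStable.exists_posSemidef_lyapOp_eq (h : LyapStable M₀ M) {W : Matrix ι ι ℝ}
    (hW : W.PosSemidef) : ∃ Y : Matrix ι ι ℝ, Y.PosSemidef ∧ lyapOp M₀ M Y = -W := by
  obtain ⟨Y, hY, hLY⟩ := h.exists_lyapOp_eq hW.isSymm.neg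
  exact ⟨Y, h.posSemidef_of_lyapOp hY (by rwa [hLY, neg_neg]), hLY⟩

theorem trace_mul_lyapOp (S T : Matrix ι ι ℝ) :
    (T * lyapOp M₀ M S).trace = (lyapOp M₀ᵀ (fun i => (M i)ᵀ) T * S).trace := by
  simp only [lyapOp_apply, transpose_transpose, Matrix.mul_add, Matrix.add_mul, Matrix.mul_sum,
    Matrix.sum_mul, trace_add, trace_sum]
  have h1 : (T * (M₀ᵀ * S)).trace = (T * M₀ᵀ * S).trace := by rw [Matrix.mul_assoc]
  have h2 : (T * (S * M₀)).trace = (M₀ * T * S).trace := by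
    rw [← Matrix.mul_assoc, trace_mul_comm, Matrix.mul_assoc]
  have h3 : ∀ i, (T * ((M i)ᵀ * S * M i)).trace = (M i * T * (M i)ᵀ * S).trace := fun i => by
    rw [← Matrix.mul_assoc, trace_mul_comm]
    simp only [Matrix.mul_assoc]
  rw [h1, h2, add_comm (T * M₀ᵀ * S).trace]
  simp only [h3]

/-- Stability passes to the transposed system, whose Lyapunov operator is the adjoint for the trace
form. -/
theorem LyapStable.transpose [DecidableEq ι] (h : LyapStable M₀ M) :
    LyapStable M₀ᵀ fun i => (M i)ᵀ := by
  have hinj : Function.Injective (lyapOp M₀ᵀ fun i => (M i)ᵀ) := by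
    rw [← LinearMap.ker_eq_bot, LinearMap.ker_eq_bot']
    intro T hT
    obtain ⟨Y, hY⟩ := LinearMap.injective_iff_surjective.1 h.lyapOp_injective Tᵀ
    have h1 := trace_mul_lyapOp (M₀ := M₀) (M := M) Y T
    rw [hT, Matrix.zero_mul, trace_zero, hY] at h1
    exact trace_mul_conjTranspose_self_eq_zero_iff.1
      (by rwa [conjTranspose_eq_transpose_of_trivial])
  obtain ⟨Z, hZ⟩ := LinearMap.injective_iff_surjective.1 hinj (-1)
  have hZs : Z.IsSymm := hinj (by rw [lyapOp_transpose, hZ, transpose_neg, transpose_one])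
  refine ⟨Z, posSemidef_real_iff.2 ⟨hZs, fun x => ?_⟩, by rw [hZ, neg_neg]; exact PosDef.one⟩
  obtain ⟨Y, hY, hLY⟩ := h.exists_posSemidef_lyapOp_eq (W := vecMulVec x x)
    (by simpa using posSemidef_vecMulVec_self_star x)
  have h1 := trace_mul_lyapOp (M₀ := M₀) (M := M) Y Z
  rw [hLY, hZ, Matrix.mul_neg, trace_neg, Matrix.neg_mul, trace_neg, Matrix.one_mul, neg_inj,
    mul_vecMulVec, trace_vecMulVec, dotProduct_comm] at h1
  rw [h1]
  exact hY.trace_nonneg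

/-- The detectability argument: perturb a stable system `N` by terms `U G`. A matrix `X ≥ 0` with
`𝓛 X ≤ -Gᵀ G` for the perturbed system makes it stable, because `Y + c X` is a Lyapunov matrix for
large `c` if `Y` is one of `N`. -/
theorem LyapStable.of_perturbation [DecidableEq ι] {p : Type*} [Fintype p]
    {N₀ : Matrix ι ι ℝ} {N : κ → Matrix ι ι ℝ}
    (hN : LyapStable N₀ N) (U₀ : Matrix ι p ℝ) (U : κ → Matrix ι p ℝ) (G : Matrix p ι ℝ)
    (hM₀ : M₀ = N₀ + U₀ * G) (hM : ∀ i, M i = N i + U i * G) {X : Matrix ι ι ℝ}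
    (hX : X.PosSemidef) (hLX : (-(lyapOp M₀ M X + Gᵀ * G)).PosSemidef) : LyapStable M₀ M := by
  obtain ⟨Y, hY, hLY⟩ := hN.exists_posSemidef_lyapOp_eq (W := 1) PosSemidef.one
  set W : Matrix p ι ℝ := U₀ᵀ * Y + ∑ i, (U i)ᵀ * Y * N i with hW
  set V : Matrix p p ℝ := ∑ i, (U i)ᵀ * Y * U i with hV
  have hexp : lyapOp M₀ M Y = lyapOp N₀ N Y + Gᵀ * W + Wᵀ * G + Gᵀ * V * G := by
    simp only [lyapOp_apply, hM₀, hM, hW, hV, transpose_add, transpose_mul, transpose_sum,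
      transpose_transpose, Matrix.add_mul, Matrix.mul_add, Matrix.sum_mul, Matrix.mul_sum,
      sum_add_distrib, Matrix.mul_assoc, hY.isSymm.eq]
    abel
  have hquad : ∀ x, x ⬝ᵥ lyapOp M₀ M Y *ᵥ x = -(x ⬝ᵥ x) + 2 * ((G *ᵥ x) ⬝ᵥ (W *ᵥ x))
      + (G *ᵥ x) ⬝ᵥ V *ᵥ (G *ᵥ x) := fun x => by
    have h1 : x ⬝ᵥ (Gᵀ * W) *ᵥ x = (G *ᵥ x) ⬝ᵥ (W *ᵥ x) := by
      rw [← mulVec_mulVec, dotProduct_mulVec, vecMul_transpose]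
    have h2 : x ⬝ᵥ (Wᵀ * G) *ᵥ x = (G *ᵥ x) ⬝ᵥ (W *ᵥ x) := by
      rw [← mulVec_mulVec, dotProduct_mulVec, vecMul_transpose, dotProduct_comm]
    have h3 : x ⬝ᵥ (Gᵀ * V * G) *ᵥ x = (G *ᵥ x) ⬝ᵥ V *ᵥ (G *ᵥ x) := by
      rw [Matrix.mul_assoc, ← mulVec_mulVec, dotProduct_mulVec, vecMul_transpose, mulVec_mulVec]
    rw [hexp, hLY]
    simp only [add_mulVec, dotProduct_add, neg_mulVec, one_mulVec, dotProduct_neg, h1, h2, h3]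
    ring
  set v := ∑ i, ∑ j, |V i j|
  set w := ∑ i, ∑ j, |(Wᵀ * W) i j| + 1 with hw
  have hw0 : 0 < w := by positivity
  have hv0 : 0 ≤ v := by positivity
  have hc : 0 ≤ 2 * w + v := by positivity
  refine ⟨Y + (2 * w + v) • X, hY.add (hX.smul hc), posDef_real_iff.2
    ⟨(hY.add (hX.smul hc)).isSymm.lyapOp.neg, fun x hx => ?_⟩⟩
  have hxx : 0 < x ⬝ᵥ x := by simpa using (PosDef.one (n := ι) (R := ℝ)).quad_pos hx
  have h1 := hLX.quad_nonneg x
  have h2 := quad_le_sum_abs V (G *ᵥ x)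
  have h3 : (W *ᵥ x) ⬝ᵥ (W *ᵥ x) ≤ w * (x ⬝ᵥ x) := by
    have h := quad_le_sum_abs (Wᵀ * W) x
    rw [← mulVec_mulVec, dotProduct_mulVec, vecMul_transpose] at h
    linarith
  have h4 : x ⬝ᵥ (Gᵀ * G) *ᵥ x = (G *ᵥ x) ⬝ᵥ (G *ᵥ x) := by
    rw [← mulVec_mulVec, dotProduct_mulVec, vecMul_transpose]
  -- Young's inequality `2 gᵀ h ≤ 2 w gᵀ g + (2 w)⁻¹ hᵀ h`, multiplied by `2 w`
  have h5 : 0 ≤ ((2 * w) • (G *ᵥ x) - W *ᵥ x) ⬝ᵥ ((2 * w) • (G *ᵥ x) - W *ᵥ x) :=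
    sum_nonneg fun _ _ => mul_self_nonneg _
  simp only [sub_dotProduct, dotProduct_sub, smul_dotProduct, dotProduct_smul, smul_eq_mul,
    dotProduct_comm (W *ᵥ x) (G *ᵥ x)] at h5
  simp only [map_add, map_smul, neg_mulVec, add_mulVec, smul_mulVec, dotProduct_neg,
    dotProduct_add, dotProduct_smul, smul_eq_mul, h4, hquad] at h1 ⊢
  set g := (G *ᵥ x) ⬝ᵥ (G *ᵥ x)
  set s := (G *ᵥ x) ⬝ᵥ (W *ᵥ x)
  have h6 : 2 * s ≤ 2 * w * g + (x ⬝ᵥ x) / 2 := by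
    have h7 : 2 * w * (2 * s) ≤ 2 * w * (2 * w * g + (x ⬝ᵥ x) / 2) := by linarith
    exact le_of_mul_le_mul_left h7 (by positivity)
  have h8 := mul_le_mul_of_nonneg_left (neg_nonneg.1 h1) hc
  linarith

end Lyapunov

/-! ### The Lyapunov semigroup -/

section Exponential

open Filter Topology NormedSpace

/-- A bounded operator that maps a closed convex cone into itself has an exponential that does so
too. -/
theorem NormedSpace.exp_mem_of_mapsTo {E : Type*} [NormedAddCommGroup E] [NormedSpace ℝ E]
    [CompleteSpace E] {K : Set E} (hK : IsClosed K) (h0 : (0 : E) ∈ K)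
    (hadd : ∀ x ∈ K, ∀ y ∈ K, x + y ∈ K) (hsmul : ∀ c : ℝ, 0 ≤ c → ∀ x ∈ K, c • x ∈ K)
    {T : E →L[ℝ] E} (hT : ∀ x ∈ K, T x ∈ K) {x : E} (hx : x ∈ K) : exp T x ∈ K := by
  have h1 := (exp_series_hasSum_exp' (𝕂 := ℝ) T).mapL (ContinuousLinearMap.apply ℝ E x)
  have hpow : ∀ n : ℕ, (T ^ n) x ∈ K := fun n => by
    induction n with
    | zero => simpa using hx
    | succ n ih => rw [pow_succ']; exact hT _ ih
  refine hK.mem_of_tendsto h1 (Eventually.of_forall fun s => ?_)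
  refine Finset.sum_induction _ (· ∈ K) (fun a b ha hb => hadd a ha b hb) h0 fun n _ => ?_
  simpa using hsmul _ (by positivity) _ (hpow n)

variable {n k : ℕ}

/-- A linear operator on matrices as a bounded operator on the normed space
`Fin n → Fin n → ℝ`. -/
noncomputable def piCLM (T : Matrix (Fin n) (Fin n) ℝ →ₗ[ℝ] Matrix (Fin n) (Fin n) ℝ) :
    (Fin n → Fin n → ℝ) →L[ℝ] (Fin n → Fin n → ℝ) :=
  LinearMap.toContinuousLinearMap
    ((Matrix.ofLinearEquiv ℝ).symm.toLinearMap ∘ₗ T ∘ₗ (Matrix.ofLinearEquiv ℝ).toLinearMap)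

theorem lyapunovCLM_eq (M₀ : Matrix (Fin n) (Fin n) ℝ) (M : Fin k → Matrix (Fin n) (Fin n) ℝ) :
    lyapunovCLM M₀ M = piCLM (lyapOp M₀ M) := rfl

theorem isClosed_posSemidef :
    IsClosed {S : Fin n → Fin n → ℝ | (Matrix.of S).PosSemidef} := by
  simp only [posSemidef_real_iff, IsSymm, Set.ofPred_and, Set.ofPred_forall]
  have h : Continuous fun S : Fin n → Fin n → ℝ => (Matrix.of S : Matrix (Fin n) (Fin n) ℝ) :=
    continuous_id
  refine IsClosed.inter (isClosed_eq h.matrix_transpose h) (isClosed_iInter fun x => ?_)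
  exact isClosed_le continuous_const (by fun_prop)

theorem exp_posSemidef_of_mapsTo
    {T : Matrix (Fin n) (Fin n) ℝ →ₗ[ℝ] Matrix (Fin n) (Fin n) ℝ}
    (hT : ∀ S, S.PosSemidef → (T S).PosSemidef) {S : Fin n → Fin n → ℝ}
    (hS : (Matrix.of S).PosSemidef) : (Matrix.of (exp (piCLM T) S)).PosSemidef :=
  exp_mem_of_mapsTo isClosed_posSemidef PosSemidef.zero (fun _ hx _ hy => hx.add hy)
    (fun _ hc _ hx => hx.smul hc) (fun x hx => hT x hx) hS

theorem exp_add_smul_one_apply {E : Type*} [NormedAddCommGroup E] [NormedSpace ℝ E]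
    [CompleteSpace E] (T : E →L[ℝ] E) (c : ℝ) (x : E) :
    exp (T + c • 1) x = Real.exp c • exp T x := by
  have h : exp (c • (1 : E →L[ℝ] E)) = Real.exp c • 1 := by
    rw [← Algebra.algebraMap_eq_smul_one, ← Algebra.algebraMap_eq_smul_one, ← algebraMap_exp_comm,
      Real.exp_eq_exp_ℝ]
  let _ : NormedAlgebra ℚ (E →L[ℝ] E) := NormedAlgebra.restrictScalars ℚ ℝ (E →L[ℝ] E)
  rw [exp_add_of_commute ((Commute.one_right T).smul_right c), h]
  simp

theorem Matrix.PosSemidef.lyapOp_zero {ι κ : Type*} [Fintype ι] [Fintype κ] {S : Matrix ι ι ℝ}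
    (hS : S.PosSemidef) (M : κ → Matrix ι ι ℝ) : (lyapOp 0 M S).PosSemidef := by
  rw [lyapOp_apply, transpose_zero, Matrix.zero_mul, Matrix.mul_zero, zero_add, zero_add]
  exact posSemidef_sum _ fun i _ => hS.congr (M i)

/-- The Lyapunov semigroup preserves positive semidefiniteness. With `Q S = M₀ᵀ S M₀`, the operator
`𝓛 + h Q` equals `(T - 1) / h` for the positive operator
`T S = (1 + h M₀)ᵀ S (1 + h M₀) + h ∑ i, Mᵢᵀ S Mᵢ`, so it generates a positive semigroup; let
`h → 0`. -/
theorem exp_lyapunov_posSemidef (M₀ : Matrix (Fin n) (Fin n) ℝ)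
    (M : Fin k → Matrix (Fin n) (Fin n) ℝ) {t : ℝ} (ht : 0 ≤ t) {S : Fin n → Fin n → ℝ}
    (hS : (Matrix.of S).PosSemidef) :
    (Matrix.of (exp (t • lyapunovCLM M₀ M) S)).PosSemidef := by
  set L := piCLM (lyapOp M₀ M)
  set Q := piCLM (lyapOp 0 fun _ : Fin 1 => M₀)
  have hlim : Tendsto (fun h : ℝ => exp (t • (L + h • Q)) S) (𝓝[>] 0)
      (𝓝 (exp (t • L) S)) := by
    let _ : NormedAlgebra ℚ ((Fin n → Fin n → ℝ) →L[ℝ] (Fin n → Fin n → ℝ)) :=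
      NormedAlgebra.restrictScalars ℚ ℝ _
    have hc : Continuous fun h : ℝ => exp (t • (L + h • Q)) S :=
      (exp_continuous.comp (by fun_prop : Continuous fun h : ℝ => t • (L + h • Q))).clm_apply
        continuous_const
    simpa using (hc.tendsto 0).mono_left nhdsWithin_le_nhds
  rw [lyapunovCLM_eq]
  refine isClosed_posSemidef.mem_of_tendsto hlim ?_
  filter_upwards [self_mem_nhdsWithin] with h (hh : 0 < h)
  obtain ⟨s, hs, hts⟩ : ∃ s, 0 ≤ s ∧ t = s * h := ⟨t / h, by positivity, by field_simp⟩
  set T : Matrix (Fin n) (Fin n) ℝ →ₗ[ℝ] Matrix (Fin n) (Fin n) ℝ :=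
    s • (lyapOp 0 (fun _ : Fin 1 => 1 + h • M₀) + h • lyapOp 0 M) with hT
  have hdec : t • (L + h • Q) = piCLM T + (-s) • 1 := by
    ext S : 1
    apply (Matrix.of (m := Fin n) (n := Fin n) (α := ℝ)).injective
    change t • (lyapOp M₀ M (Matrix.of S) + h • lyapOp 0 (fun _ : Fin 1 => M₀) (Matrix.of S))
      = T (Matrix.of S) + (-s) • Matrix.of S
    simp only [hT, lyapOp_apply, LinearMap.smul_apply, LinearMap.add_apply, transpose_zero,
      Matrix.zero_mul, Matrix.mul_zero, zero_add, univ_unique, sum_const, card_singleton, one_smul,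
      transpose_add, transpose_one, transpose_smul, Matrix.add_mul, Matrix.mul_add,
      Matrix.one_mul, Matrix.mul_one, Matrix.smul_mul, Matrix.mul_smul]
    rw [hts]
    module
  have hTpos : ∀ S, S.PosSemidef → (T S).PosSemidef := fun S hS => by
    exact ((hS.lyapOp_zero _).add ((hS.lyapOp_zero _).smul hh.le)).smul hs
  have hexp : Matrix.of (exp (t • (L + h • Q)) S)
      = Real.exp (-s) • Matrix.of (exp (piCLM T) S) := by
    rw [hdec, exp_add_smul_one_apply]
    rfl
  have hpos := (exp_posSemidef_of_mapsTo hTpos hS).smul (Real.exp_pos (-s)).le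
  rwa [← hexp] at hpos

/-- The quadratic form of `exp (t 𝓛) S` at `x` as a function of `t`. -/
theorem hasDerivAt_quad_exp (L : (Fin n → Fin n → ℝ) →L[ℝ] (Fin n → Fin n → ℝ))
    (S : Fin n → Fin n → ℝ) (x : Fin n → ℝ) (t : ℝ) :
    HasDerivAt (fun t : ℝ => x ⬝ᵥ Matrix.of (exp (t • L) S) *ᵥ x)
      (x ⬝ᵥ Matrix.of (exp (t • L) (L S)) *ᵥ x) t := by
  let φ : (Fin n → Fin n → ℝ) →ₗ[ℝ] ℝ :=
    { toFun := fun S => x ⬝ᵥ Matrix.of S *ᵥ x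
      map_add' := fun S T => by
        rw [← dotProduct_add, ← add_mulVec]; rfl
      map_smul' := fun c S => by
        rw [RingHom.id_apply, ← dotProduct_smul, ← smul_mulVec]; rfl }
  have h1 : HasDerivAt (fun t : ℝ => exp (t • L) S) (exp (t • L) (L S)) t := by
    simpa using (hasDerivAt_exp_smul_const (𝕂 := ℝ) L t).clm_apply (hasDerivAt_const t S)
  exact (LinearMap.toContinuousLinearMap φ).hasFDerivAt.comp_hasDerivAt t h1

/-- If `𝓛 S ≤ -a S`, then `exp (a t) exp (t 𝓛) S` decreases in `t ≥ 0`. -/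
theorem quad_exp_antitoneOn {M₀ : Matrix (Fin n) (Fin n) ℝ}
    {M : Fin k → Matrix (Fin n) (Fin n) ℝ} {a : ℝ} {S : Fin n → Fin n → ℝ}
    (hS : (-(lyapOp M₀ M (Matrix.of S) + a • Matrix.of S)).PosSemidef) (x : Fin n → ℝ) :
    AntitoneOn (fun t : ℝ => Real.exp (a * t) *
      (x ⬝ᵥ Matrix.of (exp (t • lyapunovCLM M₀ M) S) *ᵥ x)) (Set.Ici 0) := by
  have hd : ∀ t : ℝ, HasDerivAt (fun t : ℝ => Real.exp (a * t) *
      (x ⬝ᵥ Matrix.of (exp (t • lyapunovCLM M₀ M) S) *ᵥ x)) _ t := fun t =>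
    (((hasDerivAt_id t).const_mul a).exp).mul (hasDerivAt_quad_exp (lyapunovCLM M₀ M) S x t)
  refine antitoneOn_of_deriv_nonpos (convex_Ici 0)
    (fun t _ => (hd t).continuousAt.continuousWithinAt)
    (fun t _ => (hd t).differentiableAt.differentiableWithinAt) fun t ht => ?_
  rw [interior_Ici, Set.mem_Ioi] at ht
  rw [(hd t).deriv]
  have h1 := (exp_lyapunov_posSemidef M₀ M ht.le
    (S := -(lyapunovCLM M₀ M S + a • S)) hS).quad_nonneg x
  have h2 : exp (t • lyapunovCLM M₀ M) (-(lyapunovCLM M₀ M S + a • S))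
      = -(exp (t • lyapunovCLM M₀ M) (lyapunovCLM M₀ M S)
        + a • exp (t • lyapunovCLM M₀ M) S) := by simp
  rw [h2] at h1
  change 0 ≤ x ⬝ᵥ (-(Matrix.of (exp (t • lyapunovCLM M₀ M) (lyapunovCLM M₀ M S))
    + a • Matrix.of (exp (t • lyapunovCLM M₀ M) S))) *ᵥ x at h1
  simp only [neg_mulVec, add_mulVec, smul_mulVec, dotProduct_neg, dotProduct_add, dotProduct_smul,
    smul_eq_mul] at h1
  simp only [id_eq, mul_one]
  nlinarith [Real.exp_pos (a * t)]

/-- The comparison principle for an exponentially stable system: `exp (t 𝓛) S` decreases in `t` and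
tends to `0`. -/
theorem SystemStable.posSemidef_of_lyapOp {M₀ : Matrix (Fin n) (Fin n) ℝ}
    {M : Fin k → Matrix (Fin n) (Fin n) ℝ} (h : SystemStable M₀ M)
    {S : Matrix (Fin n) (Fin n) ℝ} (hS : S.IsSymm) (hLS : (-lyapOp M₀ M S).PosSemidef) :
    S.PosSemidef := by
  obtain ⟨β, α, hα, hb⟩ := h
  refine posSemidef_real_iff.2 ⟨hS, fun x => ?_⟩
  let S' : Fin n → Fin n → ℝ := Matrix.of.symm S
  have hlim : Tendsto (fun t : ℝ => exp (t • lyapunovCLM M₀ M) S') atTop (𝓝 0) := by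
    refine squeeze_zero_norm' ((eventually_ge_atTop 0).mono fun t ht => hb t ht S' hS) ?_
    have h1 : Tendsto (fun t : ℝ => Real.exp (-α * t)) atTop (𝓝 0) :=
      Real.tendsto_exp_atBot.comp (tendsto_id.const_mul_atTop_of_neg (neg_lt_zero.2 hα))
    simpa using (h1.const_mul β).mul_const ‖S'‖
  have hq : Continuous fun S : Fin n → Fin n → ℝ => x ⬝ᵥ Matrix.of S *ᵥ x := by
    have h : Continuous fun S : Fin n → Fin n → ℝ => (Matrix.of S : Matrix (Fin n) (Fin n) ℝ) :=
      continuous_id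
    fun_prop
  have hlim' := (hq.tendsto 0).comp hlim
  have h0 : x ⬝ᵥ Matrix.of (0 : Fin n → Fin n → ℝ) *ᵥ x = 0 := by
    change x ⬝ᵥ (0 : Matrix (Fin n) (Fin n) ℝ) *ᵥ x = 0
    simp
  rw [h0] at hlim'
  refine le_of_tendsto hlim' ((eventually_ge_atTop 0).mono fun t ht => ?_)
  have := quad_exp_antitoneOn (M₀ := M₀) (M := M) (a := 0) (S := S')
    (by simpa [S'] using hLS) x Set.self_mem_Ici ht ht
  simpa [S'] using this

theorem SystemStable.lyapStable {M₀ : Matrix (Fin n) (Fin n) ℝ}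
    {M : Fin k → Matrix (Fin n) (Fin n) ℝ} (h : SystemStable M₀ M) : LyapStable M₀ M := by
  -- the decay bounds concern symmetric matrices only, so `𝓛 Z = -1` is solved among them
  let V : Submodule ℝ (Matrix (Fin n) (Fin n) ℝ) :=
    { carrier := {S | S.IsSymm}
      add_mem' := fun ha hb => ha.add hb
      zero_mem' := isSymm_zero
      smul_mem' := fun c _ ha => ha.smul c }
  let T : V →ₗ[ℝ] V := (lyapOp M₀ M).restrict fun S (hS : S.IsSymm) => hS.lyapOp
  have hT : Function.Injective T := by
    rw [← LinearMap.ker_eq_bot, LinearMap.ker_eq_bot']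
    rintro ⟨S, hS : S.IsSymm⟩ h0
    have h0' : lyapOp M₀ M S = 0 := congrArg Subtype.val h0
    have h1 := h.posSemidef_of_lyapOp hS (by rw [h0', neg_zero]; exact PosSemidef.zero)
    have h2 := h.posSemidef_of_lyapOp hS.neg
      (by rw [map_neg, h0', neg_zero, neg_zero]; exact PosSemidef.zero)
    exact Subtype.ext (h1.eq_zero_of_neg h2)
  obtain ⟨⟨Z, hZ⟩, hLZ⟩ := LinearMap.injective_iff_surjective.1 hT ⟨-1, isSymm_one.neg⟩
  have hLZ' : lyapOp M₀ M Z = -1 := congrArg Subtype.val hLZ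
  refine ⟨Z, h.posSemidef_of_lyapOp hZ ?_, ?_⟩ <;> rw [hLZ', neg_neg]
  exacts [PosSemidef.one, PosDef.one]

/-- A Lyapunov matrix `Z` satisfies `𝓛 Z ≤ -a Z` with some `a > 0`, so that
`exp (t 𝓛) Z ≤ exp (-a t) Z`; every symmetric `S` lies between multiples of `Z` proportional
to `‖S‖`. -/
theorem LyapStable.systemStable {M₀ : Matrix (Fin n) (Fin n) ℝ}
    {M : Fin k → Matrix (Fin n) (Fin n) ℝ} (h : LyapStable M₀ M) : SystemStable M₀ M := by
  obtain ⟨Z, hZ, hLZ⟩ := h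
  have hZd := hZ.posDef_of_lyapOp hLZ
  obtain ⟨a, ha, haZ⟩ := hZd.exists_pos_smul_le hLZ
  obtain ⟨ε, hε, hεZ⟩ := (PosDef.one (n := Fin n) (R := ℝ)).exists_pos_smul_le hZd
  set N : ℝ := (n : ℝ) * n with hN
  refine ⟨N / ε * Z.trace, a, ha, fun t ht S hS => ?_⟩
  let Z' : Fin n → Fin n → ℝ := Matrix.of.symm Z
  have hP := fun {S : Fin n → Fin n → ℝ} => exp_lyapunov_posSemidef M₀ M ht (S := S)
  set P := exp (t • lyapunovCLM M₀ M)
  set c : ℝ := N / ε * ‖S‖ with hc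
  have hc0 : 0 ≤ c := by positivity
  -- `T ≤ n² ‖S‖ ≤ c Z`, as the entries of `T` are at most `‖S‖` and `ε ≤ Z`
  have hdom : ∀ T : Matrix (Fin n) (Fin n) ℝ, T.IsSymm → (∀ i j, |T i j| ≤ ‖S‖) →
      (c • Z - T).PosSemidef := by
    intro T hT hTn
    refine posSemidef_real_iff.2 ⟨(hZ.isSymm.smul c).sub hT, fun x => ?_⟩
    have h1 := quad_le_sum_abs T x
    have h2 : ∑ i, ∑ j, |T i j| ≤ N * ‖S‖ := by
      calc ∑ i, ∑ j, |T i j| ≤ ∑ _i : Fin n, ∑ _j : Fin n, ‖S‖ :=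
            sum_le_sum fun i _ => sum_le_sum fun j _ => hTn i j
        _ = N * ‖S‖ := by simp [hN, mul_assoc]
    have h3 := hεZ.quad_nonneg x
    have hxx : 0 ≤ x ⬝ᵥ x := sum_nonneg fun _ _ => mul_self_nonneg _
    simp only [sub_mulVec, smul_mulVec, one_mulVec, dotProduct_sub, dotProduct_smul,
      smul_eq_mul] at h3 ⊢
    have h4 : c * (ε * (x ⬝ᵥ x)) = N * ‖S‖ * (x ⬝ᵥ x) := by
      rw [hc]; field_simp
    have h5 := mul_le_mul_of_nonneg_left (sub_nonneg.1 h3) hc0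
    have h6 := mul_le_mul_of_nonneg_right h2 hxx
    linarith
  have hentry : ∀ i j, |S i j| ≤ ‖S‖ := fun i j =>
    (norm_le_pi_norm (S i) j).trans (norm_le_pi_norm S i)
  have h1 := hP (S := c • Z' - S) (hdom (Matrix.of S) hS hentry)
  have h2 := hP (S := c • Z' + S) (by
    have := hdom (-Matrix.of S) hS.neg fun i j => by simpa using hentry i j
    rwa [sub_neg_eq_add] at this)
  rw [map_sub, map_smul] at h1
  rw [map_add, map_smul] at h2
  have hdecay : ∀ x, x ⬝ᵥ Matrix.of (P Z') *ᵥ x ≤ Real.exp (-a * t) * (x ⬝ᵥ Z *ᵥ x) := by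
    intro x
    have h3 := quad_exp_antitoneOn (M₀ := M₀) (M := M) (a := a) (S := Z')
      (by rw [neg_add]; exact haZ) x Set.self_mem_Ici ht ht
    simp only [mul_zero, Real.exp_zero, one_mul, zero_smul, exp_zero] at h3
    have h4 : Real.exp (-a * t) * Real.exp (a * t) = 1 := by
      rw [← Real.exp_add]; simp
    have h5 := mul_le_mul_of_nonneg_left h3 (Real.exp_pos (-a * t)).le
    rw [← mul_assoc, h4, one_mul] at h5
    exact h5
  have htr : (Matrix.of (P Z')).trace ≤ Real.exp (-a * t) * Z.trace := by
    simp only [trace, mul_sum]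
    refine sum_le_sum fun i _ => ?_
    have := hdecay (Pi.single i 1)
    rwa [mulVec_single_one, mulVec_single_one, single_one_dotProduct, single_one_dotProduct] at this
  have hβ : 0 ≤ Z.trace := hZ.trace_nonneg
  rw [pi_norm_le_iff_of_nonneg (by positivity)]
  refine fun i => (pi_norm_le_iff_of_nonneg (by positivity)).2 fun j => ?_
  have h3 := h1.abs_apply_le_trace i j
  have h4 := h2.abs_apply_le_trace i j
  have e1 : (Matrix.of (c • P Z' - P S)).trace
      = c * (Matrix.of (P Z')).trace - (Matrix.of (P S)).trace := by
    simp [trace, mul_sum]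
  have e2 : (Matrix.of (c • P Z' + P S)).trace
      = c * (Matrix.of (P Z')).trace + (Matrix.of (P S)).trace := by
    simp [trace, mul_sum, sum_add_distrib]
  rw [e1] at h3
  rw [e2] at h4
  simp only [of_apply, Pi.sub_apply, Pi.add_apply, Pi.smul_apply, smul_eq_mul, abs_le] at h3 h4
  have h5 := mul_le_mul_of_nonneg_left htr hc0
  have h6 : N / ε * Z.trace * Real.exp (-a * t) * ‖S‖ = c * (Real.exp (-a * t) * Z.trace) := by
    rw [hc]; ring
  rw [h6, Real.norm_eq_abs, abs_le]
  constructor <;> linarith [h3.1, h3.2, h4.1, h4.2]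

theorem systemStable_iff_lyapStable {M₀ : Matrix (Fin n) (Fin n) ℝ}
    {M : Fin k → Matrix (Fin n) (Fin n) ℝ} : SystemStable M₀ M ↔ LyapStable M₀ M :=
  ⟨SystemStable.lyapStable, LyapStable.systemStable⟩

end Exponential

/-! ### Blocks, closed loops and completion of squares -/

namespace StdSCARE

variable {n m k : ℕ} (E : StdSCARE n m k)

/-- The block `Aᵢ` of `Πᵀ Â`, the state coefficient of the `i`-th noise process. -/
def noiseA (i : Fin k) : Matrix (Fin n) (Fin n) ℝ := blockOf ((shuffle n k)ᵀ * E.Ahat) i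

/-- The block `Bᵢ` of `Πᵀ B̂`, the control coefficient of the `i`-th noise process. -/
def noiseB (i : Fin k) : Matrix (Fin n) (Fin m) ℝ := blockOf ((shuffle n k)ᵀ * E.Bhat) i

end StdSCARE

theorem shuffle_transpose_mul_apply {n k q : ℕ} (M : Matrix (Fin n × Fin k) (Fin q) ℝ)
    (i : Fin k) (a : Fin n) (j : Fin q) : ((shuffle n k)ᵀ * M) (i, a) j = M (a, i) j := by
  rw [Matrix.mul_apply, Finset.sum_eq_single (a, i)]
  · simp [shuffle, Matrix.one_apply]
  · intro b _ hb
    simp [shuffle, hb]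
  · simp

theorem blockOf_shuffle_add_mul {n k p q : ℕ} (M : Matrix (Fin n × Fin k) (Fin q) ℝ)
    (N : Matrix (Fin n × Fin k) (Fin p) ℝ) (F : Matrix (Fin p) (Fin q) ℝ) (i : Fin k) :
    blockOf ((shuffle n k)ᵀ * (M + N * F)) i
      = blockOf ((shuffle n k)ᵀ * M) i + blockOf ((shuffle n k)ᵀ * N) i * F := by
  ext a j
  simp only [blockOf, Matrix.of_apply, Matrix.add_apply, shuffle_transpose_mul_apply]
  rw [Matrix.mul_apply, Matrix.mul_apply]
  simp only [Matrix.of_apply]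

/-- `Mᵀ ⋉ X ⋉ N` is a sum over the blocks of `Πᵀ M` and `Πᵀ N`. -/
theorem semiTensor_mul_eq_sum {n k p q : ℕ} (M : Matrix (Fin n × Fin k) (Fin p) ℝ)
    (N : Matrix (Fin n × Fin k) (Fin q) ℝ) (X : Matrix (Fin n) (Fin n) ℝ) :
    Mᵀ ⋉ X * N = ∑ i, (blockOf ((shuffle n k)ᵀ * M) i)ᵀ * X * blockOf ((shuffle n k)ᵀ * N) i := by
  ext a b
  simp only [semiTensor, Matrix.sum_apply, Matrix.mul_apply, blockOf, Matrix.of_apply,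
    Matrix.transpose_apply, kroneckerMap_apply, Fintype.sum_prod_type, Matrix.one_apply, shuffle,
    Matrix.submatrix_apply, id_eq, Prod.swap_prod_mk, Prod.mk.injEq]
  simp only [ite_and, mul_ite, mul_one, mul_zero, ite_mul, zero_mul, one_mul,
    sum_ite_eq', mem_univ, if_true]
  rw [sum_comm]
  simp [Finset.sum_ite_eq']

namespace StdSCARE

variable {n m k : ℕ} (E : StdSCARE n m k)

theorem weight_eq (X : Matrix (Fin n) (Fin n) ℝ) :
    E.weight X = 1 + ∑ i, (E.noiseB i)ᵀ * X * E.noiseB i := by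
  rw [weight, semiTensor_mul_eq_sum]; rfl

theorem cross_eq (X : Matrix (Fin n) (Fin n) ℝ) :
    E.cross X = X * E.B + ∑ i, (E.noiseA i)ᵀ * X * E.noiseB i := by
  rw [cross, semiTensor_mul_eq_sum]; rfl

theorem closedLoop_eq (F : Matrix (Fin m) (Fin n) ℝ) :
    blockOf ((shuffle n k)ᵀ * E.Ahat + (shuffle n k)ᵀ * E.Bhat * F)
      = fun i => E.noiseA i + E.noiseB i * F := by
  funext i
  rw [Matrix.mul_assoc, ← Matrix.mul_add, blockOf_shuffle_add_mul]; rfl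

/-- The closed-loop Lyapunov operator under the feedback `u = F x`. -/
def closedOp (F : Matrix (Fin m) (Fin n) ℝ) :
    Matrix (Fin n) (Fin n) ℝ →ₗ[ℝ] Matrix (Fin n) (Fin n) ℝ :=
  lyapOp (E.A + E.B * F) fun i => E.noiseA i + E.noiseB i * F

/-- The feedback `F` makes the closed-loop system stable. -/
def ClosedStable (F : Matrix (Fin m) (Fin n) ℝ) : Prop :=
  LyapStable (E.A + E.B * F) fun i => E.noiseA i + E.noiseB i * F

theorem isStabilizingSolution_iff {X : Matrix (Fin n) (Fin n) ℝ} :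
    E.IsStabilizingSolution X ↔ E.IsSolution X ∧ E.ClosedStable (E.feedback X) := by
  rw [IsStabilizingSolution, closedLoop_eq, systemStable_iff_lyapStable, ClosedStable]

/-- The polarized Lyapunov form
`H + Fᵀ G + (A + B F)ᵀ X + X (A + B G) + ∑ (Aᵢ + Bᵢ F)ᵀ X (Aᵢ + Bᵢ G)` of the Riccati residual,
for a pair of feedbacks. -/
def mixedResidual (F G : Matrix (Fin m) (Fin n) ℝ) (X : Matrix (Fin n) (Fin n) ℝ) :
    Matrix (Fin n) (Fin n) ℝ :=
  E.H + Fᵀ * G + ((E.A + E.B * F)ᵀ * X + X * (E.A + E.B * G)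
    + ∑ i, (E.noiseA i + E.noiseB i * F)ᵀ * X * (E.noiseA i + E.noiseB i * G))

theorem mixedResidual_self (F : Matrix (Fin m) (Fin n) ℝ) (X : Matrix (Fin n) (Fin n) ℝ) :
    E.mixedResidual F F X = E.H + Fᵀ * F + E.closedOp F X := rfl

variable {E} {X : Matrix (Fin n) (Fin n) ℝ}

theorem isSymm_weight (hX : X.IsSymm) : (E.weight X).IsSymm := by
  simp only [weight_eq, IsSymm, transpose_add, transpose_one, transpose_sum, transpose_mul,
    transpose_transpose, hX.eq, Matrix.mul_assoc]

theorem posDef_weight (hX : X.PosSemidef) : (E.weight X).PosDef := by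
  rw [weight_eq]
  exact PosDef.one.add_posSemidef (posSemidef_sum _ fun i _ => hX.congr _)

theorem mixedResidual_expand (F G : Matrix (Fin m) (Fin n) ℝ) (hX : X.IsSymm) :
    E.mixedResidual F G X = E.H + E.Aᵀ * X + X * E.A + E.Ahatᵀ ⋉ X * E.Ahat
      + Fᵀ * (E.cross X)ᵀ + E.cross X * G + Fᵀ * E.weight X * G := by
  rw [semiTensor_mul_eq_sum]
  change _ = E.H + E.Aᵀ * X + X * E.A + ∑ i, (E.noiseA i)ᵀ * X * E.noiseA i
      + Fᵀ * (E.cross X)ᵀ + E.cross X * G + Fᵀ * E.weight X * G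
  simp only [mixedResidual, cross_eq, weight_eq, transpose_add, transpose_mul, transpose_sum,
    transpose_transpose, hX.eq, Matrix.add_mul, Matrix.mul_add, Matrix.sum_mul, Matrix.mul_sum,
    sum_add_distrib, Matrix.mul_assoc, Matrix.mul_one]
  abel

theorem weight_mul_feedback (hu : IsUnit (E.weight X)) :
    E.weight X * E.feedback X = -(E.cross X)ᵀ := by
  rw [feedback, Matrix.mul_neg, mul_nonsing_inv_cancel_left _ _ ((isUnit_iff_isUnit_det _).1 hu)]

theorem feedback_transpose_mul_weight (hX : X.IsSymm) (hu : IsUnit (E.weight X)) :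
    (E.feedback X)ᵀ * E.weight X = -E.cross X := by
  have h := congrArg transpose (weight_mul_feedback hu)
  rwa [transpose_mul, transpose_neg, transpose_transpose, (isSymm_weight hX).eq] at h

/-- If one of the two feedbacks is the one belonging to `X`, the other one drops out. -/
theorem mixedResidual_feedback_right (F : Matrix (Fin m) (Fin n) ℝ) (hX : X.IsSymm)
    (hu : IsUnit (E.weight X)) : E.mixedResidual F (E.feedback X) X = E.residual X := by
  rw [mixedResidual_expand _ _ hX, Matrix.mul_assoc, weight_mul_feedback hu, residual, feedback]
  simp only [Matrix.mul_neg, Matrix.mul_assoc]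
  abel

theorem mixedResidual_feedback_left (G : Matrix (Fin m) (Fin n) ℝ) (hX : X.IsSymm)
    (hu : IsUnit (E.weight X)) : E.mixedResidual (E.feedback X) G X = E.residual X := by
  rw [← mixedResidual_feedback_right (E.feedback X) hX hu, mixedResidual_expand _ _ hX,
    mixedResidual_expand _ _ hX, feedback_transpose_mul_weight hX hu]
  simp only [Matrix.neg_mul]
  abel

/-- Completion of squares in the feedback. -/
theorem mixedResidual_self_eq (F : Matrix (Fin m) (Fin n) ℝ) (hX : X.IsSymm)
    (hu : IsUnit (E.weight X)) : E.mixedResidual F F X =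
      E.residual X + (F - E.feedback X)ᵀ * E.weight X * (F - E.feedback X) := by
  rw [← mixedResidual_feedback_right F hX hu, mixedResidual_expand _ _ hX,
    mixedResidual_expand _ _ hX, transpose_sub, Matrix.mul_sub, Matrix.sub_mul, Matrix.sub_mul,
    Matrix.sub_mul, feedback_transpose_mul_weight hX hu, Matrix.mul_assoc Fᵀ _ (E.feedback X)]
  simp only [Matrix.neg_mul]
  abel

/-! ### The shifted equation -/

section Incorporate

variable {PX : Matrix (Fin m) (Fin m) ℝ}

theorem isUnit_det_factor (hu : IsUnit (E.weight X)) (hPX : PXᵀ * PX = E.weight X) :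
    IsUnit PX.det := by
  rw [isUnit_iff_isUnit_det, ← hPX, det_mul] at hu
  exact isUnit_of_mul_isUnit_right hu

/-- `P_X⁻¹ L_Xᵀ = -F_X`: the state coefficients of the shifted equation are those of the closed loop
of `X`. -/
theorem inv_factor_mul_crossT (hX : X.IsSymm) (hPX : PXᵀ * PX = E.weight X) :
    PX⁻¹ * E.crossT X PX = -E.feedback X := by
  have h : E.crossT X PX = (PX⁻¹)ᵀ * (E.cross X)ᵀ := by
    simp only [crossT, cross, semiTensor, transpose_add, transpose_mul, transpose_transpose,
      hX.eq, Matrix.mul_add, Matrix.mul_assoc, ← kroneckerMap_transpose, transpose_one]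
  rw [h, feedback, neg_neg, ← hPX, Matrix.mul_inv_rev, transpose_nonsing_inv, Matrix.mul_assoc]

theorem incorporate_A (hX : X.IsSymm) (hPX : PXᵀ * PX = E.weight X) :
    (E.incorporate X PX).A = E.A + E.B * E.feedback X := by
  change E.A - E.B * PX⁻¹ * E.crossT X PX = _
  rw [Matrix.mul_assoc, inv_factor_mul_crossT hX hPX, Matrix.mul_neg, sub_neg_eq_add]

theorem incorporate_noiseA (hX : X.IsSymm) (hPX : PXᵀ * PX = E.weight X) (i : Fin k) :
    (E.incorporate X PX).noiseA i = E.noiseA i + E.noiseB i * E.feedback X := by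
  change blockOf ((shuffle n k)ᵀ * (E.Ahat - E.Bhat * PX⁻¹ * E.crossT X PX)) i = _
  rw [Matrix.mul_assoc, inv_factor_mul_crossT hX hPX, Matrix.mul_neg, sub_neg_eq_add,
    blockOf_shuffle_add_mul]
  rfl

theorem incorporate_B : (E.incorporate X PX).B = E.B * PX⁻¹ := rfl

theorem incorporate_H : (E.incorporate X PX).H = E.residual X := rfl

theorem incorporate_noiseB (i : Fin k) :
    (E.incorporate X PX).noiseB i = E.noiseB i * PX⁻¹ := by
  have h := blockOf_shuffle_add_mul (k := k) (n := n) 0 E.Bhat PX⁻¹ i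
  rw [zero_add, Matrix.mul_zero] at h
  have h0 : blockOf (0 : Matrix (Fin k × Fin n) (Fin m) ℝ) i = 0 := rfl
  rw [h0, zero_add] at h
  exact h

theorem incorporate_weight (hu : IsUnit (E.weight X)) (hPX : PXᵀ * PX = E.weight X)
    (Δ : Matrix (Fin n) (Fin n) ℝ) :
    (E.incorporate X PX).weight Δ = (PX⁻¹)ᵀ * E.weight (X + Δ) * PX⁻¹ := by
  have hP := isUnit_det_factor hu hPX
  have h1 : (PX⁻¹)ᵀ * E.weight X * PX⁻¹ = 1 := by
    rw [← hPX, ← Matrix.mul_assoc, ← transpose_mul, mul_nonsing_inv _ hP, transpose_one,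
      Matrix.one_mul, mul_nonsing_inv _ hP]
  have h2 : E.weight (X + Δ) = E.weight X + ∑ i, (E.noiseB i)ᵀ * Δ * E.noiseB i := by
    simp only [weight_eq, Matrix.mul_add, Matrix.add_mul, sum_add_distrib, add_assoc]
  rw [h2, Matrix.mul_add, Matrix.add_mul, h1, weight_eq]
  simp only [incorporate_noiseB, transpose_mul, Matrix.mul_sum, Matrix.sum_mul, Matrix.mul_assoc]

theorem isUnit_incorporate_weight (hu : IsUnit (E.weight X)) (hPX : PXᵀ * PX = E.weight X)
    (Δ : Matrix (Fin n) (Fin n) ℝ) :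
    IsUnit ((E.incorporate X PX).weight Δ) ↔ IsUnit (E.weight (X + Δ)) := by
  have hP := isUnit_det_factor hu hPX
  have hP' : IsUnit (PX⁻¹).det := (isUnit_nonsing_inv_det_iff).2 hP
  rw [incorporate_weight hu hPX, isUnit_iff_isUnit_det, isUnit_iff_isUnit_det, det_mul, det_mul,
    det_transpose, IsUnit.mul_iff, IsUnit.mul_iff]
  exact ⟨fun h => h.1.2, fun h => ⟨⟨hP', h⟩, hP'⟩⟩

theorem incorporate_cross (hX : X.IsSymm) (hu : IsUnit (E.weight X))
    (hPX : PXᵀ * PX = E.weight X) (Δ : Matrix (Fin n) (Fin n) ℝ) :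
    (E.incorporate X PX).cross Δ
      = (E.cross (X + Δ) + (E.feedback X)ᵀ * E.weight (X + Δ)) * PX⁻¹ := by
  have h1 : E.cross (X + Δ) + (E.feedback X)ᵀ * E.weight (X + Δ)
      = Δ * E.B + ∑ i, (E.noiseA i + E.noiseB i * E.feedback X)ᵀ * Δ * E.noiseB i := by
    have h2 : E.cross X + (E.feedback X)ᵀ * E.weight X = 0 := by
      rw [feedback_transpose_mul_weight hX hu, add_neg_cancel]
    rw [← sub_zero (E.cross (X + Δ) + _), ← h2]
    simp only [cross_eq, weight_eq, Matrix.mul_add, Matrix.add_mul, sum_add_distrib,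
      transpose_add, transpose_mul, Matrix.mul_sum, Matrix.mul_assoc]
    abel
  rw [h1, cross_eq]
  simp only [incorporate_noiseB, incorporate_noiseA hX hPX, incorporate_B, Matrix.add_mul,
    Matrix.sum_mul, Matrix.mul_assoc]

theorem incorporate_feedback (hX : X.IsSymm) (hu : IsUnit (E.weight X))
    (hPX : PXᵀ * PX = E.weight X) {Δ : Matrix (Fin n) (Fin n) ℝ} (hΔ : Δ.IsSymm)
    (hu' : IsUnit (E.weight (X + Δ))) :
    (E.incorporate X PX).feedback Δ = PX * (E.feedback (X + Δ) - E.feedback X) := by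
  have hP := isUnit_det_factor hu hPX
  have hud := (isUnit_iff_isUnit_det _).1 ((isUnit_incorporate_weight hu hPX Δ).2 hu')
  have key : (E.incorporate X PX).weight Δ * (PX * (E.feedback (X + Δ) - E.feedback X))
      = -((E.incorporate X PX).cross Δ)ᵀ := by
    rw [incorporate_weight hu hPX, incorporate_cross hX hu hPX, Matrix.mul_assoc,
      nonsing_inv_mul_cancel_left _ _ hP, Matrix.mul_assoc, Matrix.mul_sub,
      weight_mul_feedback hu', transpose_mul, transpose_add, transpose_mul, transpose_transpose,
      (isSymm_weight (hX.add hΔ)).eq, ← Matrix.mul_neg, neg_add']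
  rw [feedback, ← Matrix.mul_neg, ← key, nonsing_inv_mul_cancel_left _ _ hud]

theorem incorporate_closedLoop (hX : X.IsSymm) (hu : IsUnit (E.weight X))
    (hPX : PXᵀ * PX = E.weight X) {Δ : Matrix (Fin n) (Fin n) ℝ} (hΔ : Δ.IsSymm)
    (hu' : IsUnit (E.weight (X + Δ))) :
    (E.incorporate X PX).A + (E.incorporate X PX).B * (E.incorporate X PX).feedback Δ
        = E.A + E.B * E.feedback (X + Δ) ∧
      ∀ i, (E.incorporate X PX).noiseA i
          + (E.incorporate X PX).noiseB i * (E.incorporate X PX).feedback Δ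
        = E.noiseA i + E.noiseB i * E.feedback (X + Δ) := by
  have hP := isUnit_det_factor hu hPX
  rw [incorporate_feedback hX hu hPX hΔ hu']
  refine ⟨?_, fun i => ?_⟩
  · rw [incorporate_A hX hPX, incorporate_B, Matrix.mul_assoc,
      nonsing_inv_mul_cancel_left _ _ hP, Matrix.mul_sub]
    abel
  · rw [incorporate_noiseA hX hPX, incorporate_noiseB, Matrix.mul_assoc,
      nonsing_inv_mul_cancel_left _ _ hP, Matrix.mul_sub]
    abel

theorem incorporate_closedStable_iff (hX : X.IsSymm) (hu : IsUnit (E.weight X))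
    (hPX : PXᵀ * PX = E.weight X) {Δ : Matrix (Fin n) (Fin n) ℝ} (hΔ : Δ.IsSymm)
    (hu' : IsUnit (E.weight (X + Δ))) :
    (E.incorporate X PX).ClosedStable ((E.incorporate X PX).feedback Δ)
      ↔ E.ClosedStable (E.feedback (X + Δ)) := by
  obtain ⟨h1, h2⟩ := incorporate_closedLoop hX hu hPX hΔ hu'
  simp only [ClosedStable, h1, h2]

/-- Both residuals are evaluated along the common closed loop with feedback `F_{X + Δ}`; the
square completed at `X` accounts for the change of the control variable. -/
theorem incorporate_residual (hX : X.IsSymm) (hu : IsUnit (E.weight X))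
    (hPX : PXᵀ * PX = E.weight X) {Δ : Matrix (Fin n) (Fin n) ℝ} (hΔ : Δ.IsSymm)
    (hu' : IsUnit (E.weight (X + Δ))) :
    (E.incorporate X PX).residual Δ = E.residual (X + Δ) := by
  obtain ⟨h1, h2⟩ := incorporate_closedLoop hX hu hPX hΔ hu'
  rw [← mixedResidual_feedback_right (E.feedback (X + Δ)) (hX.add hΔ) hu',
    ← mixedResidual_feedback_right ((E.incorporate X PX).feedback Δ) hΔ
      ((isUnit_incorporate_weight hu hPX Δ).2 hu'),
    mixedResidual_self, mixedResidual_self, closedOp, closedOp, map_add, h1]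
  simp only [h2]
  have h3 := mixedResidual_self_eq (E.feedback (X + Δ)) hX hu
  rw [mixedResidual_self, closedOp, ← hPX] at h3
  rw [incorporate_feedback hX hu hPX hΔ hu', ← add_assoc, h3, incorporate_H, transpose_mul]
  simp only [Matrix.mul_assoc]

theorem incorporate_isSolution_iff (hX : X.IsSymm) (hu : IsUnit (E.weight X))
    (hPX : PXᵀ * PX = E.weight X) (Y : Matrix (Fin n) (Fin n) ℝ) :
    (E.incorporate X PX).IsSolution (Y - X) ↔ E.IsSolution Y := by
  have hsymm : (Y - X).IsSymm ↔ Y.IsSymm :=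
    ⟨fun h => by simpa using h.add hX, fun h => h.sub hX⟩
  rw [IsSolution, IsSolution, hsymm, isUnit_incorporate_weight hu hPX, add_sub_cancel]
  refine and_congr_right fun hY => and_congr_right fun hu' => ?_
  rw [incorporate_residual hX hu hPX (hY.sub hX) (by rwa [add_sub_cancel]), add_sub_cancel]

theorem incorporate_isStabilizingSolution_iff (hX : X.IsSymm) (hu : IsUnit (E.weight X))
    (hPX : PXᵀ * PX = E.weight X) (Y : Matrix (Fin n) (Fin n) ℝ) :
    (E.incorporate X PX).IsStabilizingSolution (Y - X) ↔ E.IsStabilizingSolution Y := by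
  rw [isStabilizingSolution_iff, isStabilizingSolution_iff, incorporate_isSolution_iff hX hu hPX]
  refine and_congr_right fun hY => ?_
  rw [incorporate_closedStable_iff hX hu hPX (hY.1.sub hX)
    (by rw [add_sub_cancel]; exact hY.2.1), add_sub_cancel]

end Incorporate

end StdSCARE

/-! ### Existence and uniqueness of the stabilizing solution -/

namespace StdSCARE

variable {n m k : ℕ} {E : StdSCARE n m k}

/-- Two stabilizing solutions differ by a zero of the mixed Lyapunov operator of the two closed
loops: both mixed residuals with the two feedbacks vanish. -/
theorem IsStabilizingSolution.eq {X Y : Matrix (Fin n) (Fin n) ℝ}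
    (hX : E.IsStabilizingSolution X) (hY : E.IsStabilizingSolution Y) : X = Y := by
  rw [isStabilizingSolution_iff] at hX hY
  obtain ⟨⟨hXs, hXu, hX0⟩, hXst⟩ := hX
  obtain ⟨⟨hYs, hYu, hY0⟩, hYst⟩ := hY
  have h1 := mixedResidual_feedback_left (E.feedback Y) hXs hXu
  have h2 := mixedResidual_feedback_right (E.feedback X) hYs hYu
  rw [hX0] at h1
  rw [hY0] at h2
  refine sub_eq_zero.1 (hXst.eq_zero_of_mixed hYst ?_)
  rw [← sub_self (0 : Matrix (Fin n) (Fin n) ℝ)]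
  nth_rw 1 [← h1]
  rw [← h2]
  simp only [mixedResidual, Matrix.mul_sub, Matrix.sub_mul, sum_sub_distrib]
  abel

/-- The stabilizing solution dominates every `X ≥ 0` with nonnegative residual. -/
theorem IsStabilizingSolution.sub_posSemidef {X Y : Matrix (Fin n) (Fin n) ℝ}
    (hY : E.IsStabilizingSolution Y) (hX : X.PosSemidef) (hCX : (E.residual X).PosSemidef) :
    (Y - X).PosSemidef := by
  rw [isStabilizingSolution_iff] at hY
  obtain ⟨⟨hYs, hYu, hY0⟩, hYst⟩ := hY
  refine hYst.posSemidef_of_lyapOp (hYs.sub hX.isSymm) ?_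
  have h1 := mixedResidual_feedback_right (E.feedback Y) hYs hYu
  have hW := posDef_weight (E := E) hX
  have h2 := mixedResidual_self_eq (E.feedback Y) hX.isSymm hW.isUnit
  rw [hY0, mixedResidual_self] at h1
  rw [mixedResidual_self] at h2
  have h3 : -E.closedOp (E.feedback Y) (Y - X) = E.residual X
      + (E.feedback Y - E.feedback X)ᵀ * E.weight X * (E.feedback Y - E.feedback X) := by
    rw [← h2, ← sub_zero (_ + _ + E.closedOp _ X), ← h1, map_sub]
    abel
  change (-E.closedOp (E.feedback Y) (Y - X)).PosSemidef
  rw [h3]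
  exact hCX.add (hW.posSemidef.congr _)

/-- Under detectability, `X ≥ 0` with `H + Fᵀ F + 𝓛_F X ≤ 0` forces `F` to be stabilizing: the
closed loop is the system with output injection `A + K C`, perturbed by terms in `F` and `C`. -/
theorem closedStable_of_mixedResidual {l : ℕ} {C : Matrix (Fin l) (Fin n) ℝ}
    (hH : E.H = Cᵀ * C) {K : Matrix (Fin n) (Fin l) ℝ} (hK : LyapStable (E.A + K * C) E.noiseA)
    {F : Matrix (Fin m) (Fin n) ℝ} {X : Matrix (Fin n) (Fin n) ℝ} (hX : X.PosSemidef)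
    (h : (-E.mixedResidual F F X).PosSemidef) : E.ClosedStable F := by
  refine hK.of_perturbation (fromCols E.B (-K)) (fun i => fromCols (E.noiseB i) 0) (fromRows F C)
    ?_ (fun i => ?_) hX ?_
  · rw [fromCols_mul_fromRows, Matrix.neg_mul]
    abel
  · rw [fromCols_mul_fromRows, Matrix.zero_mul, add_zero]
  · rw [transpose_fromRows, fromCols_mul_fromRows]
    rw [mixedResidual_self, hH] at h
    convert h using 2
    rw [closedOp]
    abel

/-- A step of Newton's method: the Lyapunov equation of a stabilizing feedback has a solution
`Y ≥ 0`, and completion of squares gives `𝒞(Y) ≤ 0`. -/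
theorem ClosedStable.exists_mixedResidual_eq_zero {F : Matrix (Fin m) (Fin n) ℝ}
    (hF : E.ClosedStable F) (hH : E.H.PosSemidef) :
    ∃ Y : Matrix (Fin n) (Fin n) ℝ, Y.PosSemidef ∧ E.mixedResidual F F Y = 0 ∧
      (-E.residual Y).PosSemidef := by
  obtain ⟨Y, hY, hLY⟩ :=
    hF.exists_posSemidef_lyapOp_eq (hH.add (posSemidef_transpose_mul_self F))
  have h0 : E.mixedResidual F F Y = 0 := by
    rw [mixedResidual_self, closedOp, hLY, add_neg_cancel]
  have hW := posDef_weight (E := E) hY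
  have h1 := mixedResidual_self_eq F hY.isSymm hW.isUnit
  refine ⟨Y, hY, h0, ?_⟩
  rw [h0] at h1
  rw [neg_eq_of_add_eq_zero_right h1.symm]
  exact hW.posSemidef.congr _

theorem continuousOn_residual : ContinuousOn E.residual {X | X.PosSemidef} := by
  have hw : Continuous E.weight := by
    have : E.weight = _ := funext E.weight_eq
    rw [this]
    fun_prop
  have hc : Continuous E.cross := by
    have : E.cross = _ := funext E.cross_eq
    rw [this]
    fun_prop
  have hs : Continuous fun X : Matrix (Fin n) (Fin n) ℝ => E.Ahatᵀ ⋉ X * E.Ahat := by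
    simp only [semiTensor_mul_eq_sum]
    fun_prop
  have hinv : ContinuousOn (fun X => (E.weight X)⁻¹) {X | X.PosSemidef} := by
    simp only [Matrix.inv_def, Ring.inverse_eq_inv]
    refine ContinuousOn.smul (hw.matrix_det.continuousOn.inv₀ fun X hX => ?_)
      hw.matrix_adjugate.continuousOn
    exact ((isUnit_iff_isUnit_det _).1 (posDef_weight hX).isUnit).ne_zero
  have h1 : Continuous fun X : Matrix (Fin n) (Fin n) ℝ =>
      E.H + E.Aᵀ * X + X * E.A + E.Ahatᵀ ⋉ X * E.Ahat :=
    (by fun_prop : Continuous fun X : Matrix (Fin n) (Fin n) ℝ => E.H + E.Aᵀ * X + X * E.A).add hs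
  have h2 : ContinuousOn (fun X => E.cross X * (E.weight X)⁻¹ * (E.cross X)ᵀ)
      {X | X.PosSemidef} := by
    fun_prop
  exact h1.continuousOn.sub h2

/-- Existence of a positive semidefinite stabilizing solution. Among the `X ≥ 0` with `𝒞(X) ≤ 0`
take one with smallest trace. By detectability its feedback is stabilizing, so a Newton step
gives another element of the set below it, which has to coincide with it. -/
theorem exists_isStabilizingSolution {l : ℕ} {C : Matrix (Fin l) (Fin n) ℝ} (hH : E.H = Cᵀ * C)
    {F₀ : Matrix (Fin m) (Fin n) ℝ} (hF₀ : E.ClosedStable F₀)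
    {K : Matrix (Fin n) (Fin l) ℝ} (hK : LyapStable (E.A + K * C) E.noiseA) :
    ∃ X : Matrix (Fin n) (Fin n) ℝ, X.PosSemidef ∧ E.IsStabilizingSolution X := by
  have hHp : E.H.PosSemidef := hH ▸ posSemidef_transpose_mul_self C
  obtain ⟨X₀, hX₀, -, hR₀⟩ := hF₀.exists_mixedResidual_eq_zero hHp
  have hcl : IsClosed {X : Matrix (Fin n) (Fin n) ℝ | X.PosSemidef} := isClosed_posSemidef
  set S : Set (Matrix (Fin n) (Fin n) ℝ) :=
    {X | X.PosSemidef} ∩ (fun X => -E.residual X) ⁻¹' {X | X.PosSemidef}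
  have hSc : IsClosed S := continuousOn_residual.neg.preimage_isClosed_of_isClosed hcl hcl
  have htr : Continuous fun X : Matrix (Fin n) (Fin n) ℝ => X.trace := by fun_prop
  -- entries of a positive semidefinite matrix are bounded by its trace
  have hcomp : IsCompact (S ∩ {X | X.trace ≤ X₀.trace}) := by
    have hbox : IsCompact (Set.univ.pi fun _ : Fin n => Set.univ.pi fun _ : Fin n =>
        Set.Icc (-X₀.trace) X₀.trace) :=
      isCompact_univ_pi fun _ => isCompact_univ_pi fun _ => isCompact_Icc
    refine hbox.of_isClosed_subset (hSc.inter (isClosed_le htr continuous_const)) ?_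
    rintro X ⟨⟨hX, -⟩, hXt⟩ i - j -
    exact abs_le.1 ((PosSemidef.abs_apply_le_trace hX i j).trans hXt)
  obtain ⟨X, ⟨⟨hX, hRX⟩, hXt⟩, hmin⟩ :=
    hcomp.exists_isMinOn ⟨X₀, ⟨hX₀, hR₀⟩, le_refl X₀.trace⟩ htr.continuousOn
  replace hX : X.PosSemidef := hX
  replace hRX : (-E.residual X).PosSemidef := hRX
  have hu := (posDef_weight (E := E) hX).isUnit
  have hXF := mixedResidual_feedback_right (E.feedback X) hX.isSymm hu
  have hst : E.ClosedStable (E.feedback X) :=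
    closedStable_of_mixedResidual hH hK hX (by rwa [hXF])
  obtain ⟨Y, hY, hY0, hRY⟩ := hst.exists_mixedResidual_eq_zero hHp
  have hXY : (X - Y).PosSemidef := by
    refine hst.posSemidef_of_lyapOp (hX.isSymm.sub hY.isSymm) ?_
    have h1 : E.closedOp (E.feedback X) (X - Y) = E.residual X := by
      rw [← hXF, ← sub_zero (E.mixedResidual _ _ X), ← hY0, mixedResidual_self,
        mixedResidual_self, map_sub]
      abel
    change (-E.closedOp (E.feedback X) (X - Y)).PosSemidef
    rwa [h1]
  have hle : Y.trace ≤ X.trace := by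
    have := hXY.trace_nonneg
    rw [trace_sub] at this
    linarith
  have hge : X.trace ≤ Y.trace := hmin ⟨⟨hY, hRY⟩, hle.trans hXt⟩
  have heq : X = Y := by
    rw [← sub_eq_zero, ← hXY.trace_eq_zero_iff, trace_sub]
    linarith
  refine ⟨X, hX, E.isStabilizingSolution_iff.2 ⟨⟨hX.isSymm, hu, ?_⟩, hst⟩⟩
  exact hXF.symm.trans ((congrArg _ heq).trans hY0)

end StdSCARE

/-! ### The standard form of the original data -/

namespace SCAREData

variable {n m k l : ℕ} (D : SCAREData n m k) {P : Matrix (Fin m) (Fin m) ℝ}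
  {C : Matrix (Fin l) (Fin n) ℝ}

theorem blockOf_shuffle_stackBlocks {n k q : ℕ} (M : Fin k → Matrix (Fin n) (Fin q) ℝ)
    (i : Fin k) : blockOf ((shuffle n k)ᵀ * (shuffle n k * stackBlocks M)) i = M i := by
  have h : (shuffle n k)ᵀ * shuffle n k = 1 := by
    simpa using shuffle_transpose_mul_mul n k 1
  rw [← Matrix.mul_assoc, h, Matrix.one_mul]
  rfl

theorem stackBlocks_sub_mul {n k p q : ℕ} (M : Fin k → Matrix (Fin n) (Fin q) ℝ)
    (N : Fin k → Matrix (Fin n) (Fin p) ℝ) (F : Matrix (Fin p) (Fin q) ℝ) :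
    stackBlocks M - stackBlocks N * F = stackBlocks fun i => M i - N i * F := rfl

theorem toStd_noiseA (i : Fin k) :
    (D.toStd P C).noiseA i = D.A i - D.B i * D.R⁻¹ * D.Lᵀ := by
  change blockOf ((shuffle n k)ᵀ * (shuffle n k *
    (stackBlocks D.A - stackBlocks D.B * D.R⁻¹ * D.Lᵀ))) i = _
  rw [Matrix.mul_assoc (stackBlocks D.B), stackBlocks_sub_mul, blockOf_shuffle_stackBlocks,
    Matrix.mul_assoc]

theorem toStd_noiseB (i : Fin k) : (D.toStd P C).noiseB i = D.B i * P⁻¹ := by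
  have h : stackBlocks D.B * P⁻¹ = stackBlocks fun i => D.B i * P⁻¹ := rfl
  change blockOf ((shuffle n k)ᵀ * (shuffle n k * stackBlocks D.B * P⁻¹)) i = _
  rw [Matrix.mul_assoc (shuffle n k), h, blockOf_shuffle_stackBlocks]

/-- The feedback `F` of the original system corresponds to `P (F + R⁻¹ Lᵀ)` in standard form. -/
theorem exists_closedStable_toStd (hR : D.R.PosDef) (hP : Pᵀ * P = D.R)
    (h : Stabilizable D.A₀ D.A D.B₀ D.B) : ∃ F, (D.toStd P C).ClosedStable F := by
  obtain ⟨F, hF⟩ := h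
  have hPu : IsUnit P.det := by
    have h := (isUnit_iff_isUnit_det _).1 hR.isUnit
    rw [← hP, det_mul] at h
    exact isUnit_of_mul_isUnit_right h
  refine ⟨P * (F + D.R⁻¹ * D.Lᵀ), ?_⟩
  have hA : (D.toStd P C).A = D.A₀ - D.B₀ * D.R⁻¹ * D.Lᵀ := rfl
  have hB : (D.toStd P C).B = D.B₀ * P⁻¹ := rfl
  have hstd : ∀ (M : Matrix (Fin n) (Fin n) ℝ) (N : Matrix (Fin n) (Fin m) ℝ),
      M - N * D.R⁻¹ * D.Lᵀ + N * P⁻¹ * (P * (F + D.R⁻¹ * D.Lᵀ)) = M + N * F := fun M N => by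
    rw [Matrix.mul_assoc N P⁻¹, nonsing_inv_mul_cancel_left _ _ hPu, Matrix.mul_add,
      Matrix.mul_assoc]
    abel
  have h := hF.lyapStable
  simpa only [StdSCARE.ClosedStable, toStd_noiseA, toStd_noiseB, hA, hB, hstd] using h

/-- Detectability as an output injection that stabilizes the system itself. -/
theorem exists_lyapStable_outputInjection
    (h : Detectable (D.A₀ - D.B₀ * D.R⁻¹ * D.Lᵀ) (fun i => D.A i - D.B i * D.R⁻¹ * D.Lᵀ) C) :
    ∃ K : Matrix (Fin n) (Fin l) ℝ,
      LyapStable ((D.toStd P C).A + K * C) (D.toStd P C).noiseA := by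
  obtain ⟨F, hF⟩ := h
  refine ⟨Fᵀ, ?_⟩
  have h := hF.lyapStable.transpose
  simp only [transpose_add, transpose_mul, transpose_transpose, Matrix.zero_mul, add_zero] at h
  have hA : (D.toStd P C).A = D.A₀ - D.B₀ * D.R⁻¹ * D.Lᵀ := rfl
  have hN : (D.toStd P C).noiseA = _ := funext D.toStd_noiseA
  rw [hA, hN]
  simpa only [transpose_sub, transpose_mul, transpose_transpose, Matrix.zero_mul, add_zero,
    transpose_zero, Matrix.mul_zero] using h

end SCAREData

theorem theorem2p1 {n m k l : ℕ} (D : SCAREData n m k)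
    (P : Matrix (Fin m) (Fin m) ℝ) (C : Matrix (Fin l) (Fin n) ℝ)
    (hR : D.R.PosDef) (hQ : (Matrix.fromBlocks D.Q D.L D.Lᵀ D.R).PosSemidef)
    (hP : Pᵀ * P = D.R) (hC : Cᵀ * C = D.Q - D.L * D.R⁻¹ * D.Lᵀ)
    (X : Matrix (Fin n) (Fin n) ℝ) (hX : X.PosSemidef)
    (hCX : ((D.toStd P C).residual X).PosSemidef)
    (PX : Matrix (Fin m) (Fin m) ℝ) (hPX : PXᵀ * PX = (D.toStd P C).weight X) :
    -- the residual of the new equation at `Δ` is the residual of the old one at `X + Δ`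
    (∀ Δ : Matrix (Fin n) (Fin n) ℝ, Δ.IsSymm →
      (IsUnit (((D.toStd P C).incorporate X PX).weight Δ) ↔
        IsUnit ((D.toStd P C).weight (X + Δ))) ∧
      (IsUnit ((D.toStd P C).weight (X + Δ)) →
        ((D.toStd P C).incorporate X PX).residual Δ = (D.toStd P C).residual (X + Δ))) ∧
    (∀ Xs : Matrix (Fin n) (Fin n) ℝ,
      ((D.toStd P C).incorporate X PX).IsSolution (Xs - X) ↔ (D.toStd P C).IsSolution Xs) ∧
    -- stabilizing solutions correspond
    (∀ Xs : Matrix (Fin n) (Fin n) ℝ,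
      ((D.toStd P C).incorporate X PX).IsStabilizingSolution (Xs - X) ↔
        (D.toStd P C).IsStabilizingSolution Xs) ∧
    -- existence and uniqueness of the stabilizing solution
    (Stabilizable D.A₀ D.A D.B₀ D.B →
      Detectable (D.A₀ - D.B₀ * D.R⁻¹ * D.Lᵀ) (fun i => D.A i - D.B i * D.R⁻¹ * D.Lᵀ) C →
      ∃ Δ : Matrix (Fin n) (Fin n) ℝ, Δ.PosSemidef ∧
        ((D.toStd P C).incorporate X PX).IsStabilizingSolution Δ ∧
        ∀ Δ' : Matrix (Fin n) (Fin n) ℝ,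
          ((D.toStd P C).incorporate X PX).IsStabilizingSolution Δ' → Δ' = Δ) := by
  have hXs := hX.isSymm
  have hu := (StdSCARE.posDef_weight (E := D.toStd P C) hX).isUnit
  refine ⟨fun Δ hΔ => ⟨StdSCARE.isUnit_incorporate_weight hu hPX Δ,
      StdSCARE.incorporate_residual hXs hu hPX hΔ⟩,
    StdSCARE.incorporate_isSolution_iff hXs hu hPX,
    StdSCARE.incorporate_isStabilizingSolution_iff hXs hu hPX,
    fun hstab hdet => ?_⟩
  obtain ⟨F, hF⟩ := D.exists_closedStable_toStd (C := C) hR hP hstab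
  obtain ⟨K, hK⟩ := D.exists_lyapStable_outputInjection (P := P) hdet
  obtain ⟨Y, -, hY⟩ := StdSCARE.exists_isStabilizingSolution rfl hF hK
  refine ⟨Y - X, hY.sub_posSemidef hX hCX,
    (StdSCARE.incorporate_isStabilizingSolution_iff hXs hu hPX Y).2 hY, fun Δ' hΔ' => ?_⟩
  exact hΔ'.eq ((StdSCARE.incorporate_isStabilizingSolution_iff hXs hu hPX Y).2 hY)
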